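/- Let $a,b\ge1$ and $l\ge0$ be integers, write $[n]=\{1,\dots,n\}$, and regard $[a]\times[b]$ as a rectangle of lattice points, with $(i,j)$ in row $i$ (counted from the top) and column $j$ (counted from the left). Let $\alpha=\{\alpha_1<\dots<\alpha_r\}\subseteq[a]$ and $\beta=\{\beta_1<\dots<\beta_r\}\subseteq[b]$ be sets of the same size $r\ge0$. *Vacancy-osculation sets.* Let $\mathrm{OP}(a,b,\alpha,\beta)$ be the set of tuples $P=(P_1,\dots,P_r)$ in which $P_k$ is a lattice path from $(a,\beta_k)$ to $(\alpha_k,b)$ with steps $(0,1)$ and $(-1,0)$, and $P_k,P_{k+1}$ are osculating for each $k\in[r-1]$: at each common point $(i,j)$, the path $P_k$ comes from $(i,j-1)$ and goes on to $(i-1,j)$, while $P_{k+1}$ comes from $(i+1,j)$ (unless it starts at $(i,j)$) and goes on to $(i,j+1)$ (unless it ends at $(i,j)$). Let $Z(P)$ be the set of points of $[a]\times[b]$ which lie on no path of $P$ (vacancies) or on two different paths of $P$ (osculations), and let $\mathrm{VOS}(a,b,\alpha,\beta,l)=\{Z(P)\mid P\in\mathrm{OP}(a,b,\alpha,\beta),\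 |Z(P)|=l\}$. *The partition.* Let $\mu=(b-\beta_1,\dots,b-\beta_r\,|\,a-\alpha_1,\dots,a-\alpha_r)$ in Frobenius notation, and let $\lambda_{a,b,\alpha,\beta}=(b-\mu_a,b-\mu_{a-1},\dots,b-\mu_1)$. *Generalized oscillating tableaux.* Partitions differ by a square if one of their Young diagrams is the disjoint union of the other one and a single square $(i,j)$; the content of this square is $j-i$. An oscillating tableau of shape $\lambda$ and length $l$ is a sequence $\eta=(\eta_0=\emptyset,\eta_1,\dots,\eta_l=\lambda)$ of partitions in which $\eta_{k-1}$ and $\eta_k$ differ by a square for each $k\in[l]$; its profile is $\Omega(\eta)=(\Omega(\eta)_1,\dots,\Omega(\eta)_l)$, where $\Omega(\eta)_k$ is the content of the square by which $\eta_{k-1}$ and $\eta_k$ differ. For a total strict order $\prec$ on $\mathbb Z$ and a set $T$ of positive integers, let $\mathrm{GOT}(T,\prec,\lambda,l)$ be the set of pairs $(t,\eta)$ with $t\in T^l$ and $\eta$ an oscillating tableau of shape $\lambda$ and length $l$, such that, for each $k\in[l-1]$, $t_k<t_{k+1}$, or $t_k=t_{k+1}$ and $\Omega(\eta)_k\prec\Omega(\eta)_{k+1}$.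 *The mappings.* An ordering pair $(L,\prec)$ consists of a function $L$ from pairs of positive integers to positive integers and a total strict order $\prec$ on $\mathbb Z$, such that if $L(i,j)<L(i',j')$, or $L(i,j)=L(i',j')$ and $j-i\prec j'-i'$, then $i<i'$ or $j<j'$. For $q\in\mathbb Z$ let $L_q(i,j)=\max(i+q,j)$ if $q\le0$ and $L_q(i,j)=\max(i,j-q)$ if $q\ge0$; an ordering pair of the form $(L_q,\prec)$ is called complete. For $S\in\mathrm{VOS}(a,b,\alpha,\beta,l)$ and an ordering pair $(L,\prec)$, the progression for $S$ induced by $(L,\prec)$ is the unique ordering $s=((i_1,j_1),\dots,(i_l,j_l))$ of the elements of $S$ such that $i_k<i_{k'}$ or $j_k<j_{k'}$ whenever $k<k'$ and such that, for each $k\in[l-1]$, $L(i_k,j_k)<L(i_{k+1},j_{k+1})$, or $L(i_k,j_k)=L(i_{k+1},j_{k+1})$ and $j_k-i_k\prec j_{k+1}-i_{k+1}$; the oscillating tableau $\eta(s)$ is the unique one with profile $(j_1-i_1,\dots,j_l-i_l)$; and $\Theta_{(L,\prec)}(S)=\bigl((L(i_1,j_1),\dots,L(i_l,j_l)),\eta(s)\bigr)$.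 For $q,u,z\in\mathbb Z$ let $$G_q(u,z)=\begin{cases}(u-z,u),&q\le\min(0,z)\\(u-q,u-q+z),&z\le q\le0\\(u+q-z,u+q),&0\le q\le z\\(u,u+z),&q\ge\max(0,z),\end{cases}$$ and let $\Phi_q(t,\eta)=\{G_q(t_1,\Omega(\eta)_1),\dots,G_q(t_l,\Omega(\eta)_l)\}$. **Theorem.** Let $(L_{b-a},\prec)$ be any complete ordering pair. Then $\Theta_{(L_{b-a},\prec)}$ is well-defined on $\mathrm{VOS}(a,b,\alpha,\beta,l)$ (the induced progression $s$ and the oscillating tableau $\eta(s)$ exist and are unique for each $S$ in this set), it is a bijection from $\mathrm{VOS}(a,b,\alpha,\beta,l)$ to $\mathrm{GOT}([\min(a,b)],\prec,\lambda_{a,b,\alpha,\beta},l)$, and the inverse mapping is $\Phi_{b-a}$. -/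

import Mathlib

namespace OsculatingPaths

/-! ## Osculating paths and vacancy-osculation sets

Points of the lattice are pairs `(i, j) : ℤ × ℤ`, with `i` the row (numbered from top to bottom)
and `j` the column (numbered from left to right). -/

/-- The rectangle `[a] × [b]`. -/
noncomputable def rect (a b : ℕ) : Finset (ℤ × ℤ) := Finset.Icc 1 (a : ℤ) ×ˢ Finset.Icc 1 (b : ℤ)

/-- A pair of boundary points `(α, β)` of the `a` by `b` rectangle: `α ⊆ [a]` is the set of rows of
the end points on the right boundary, `β ⊆ [b]` is the set of columns of the start points on the
lower boundary, and `|α| = |β|`. -/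
structure BoundaryPair (a b : ℕ) where
  rows : Finset ℕ
  cols : Finset ℕ
  rows_subset : rows ⊆ Finset.Icc 1 a
  cols_subset : cols ⊆ Finset.Icc 1 b
  card_eq : rows.card = cols.card

/-- The number `r = |α| = |β|` of paths. -/
abbrev BoundaryPair.r {a b : ℕ} (p : BoundaryPair a b) : ℕ := p.rows.card

/-- `α_1 < ... < α_r`, the elements of `α` in increasing order. -/
def BoundaryPair.alpha {a b : ℕ} (p : BoundaryPair a b) : Fin p.r ↪o ℕ :=
  p.rows.orderEmbOfFin rfl

/-- `β_1 < ... < β_r`, the elements of `β` in increasing order. -/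
def BoundaryPair.beta {a b : ℕ} (p : BoundaryPair a b) : Fin p.r ↪o ℕ :=
  p.cols.orderEmbOfFin p.card_eq.symm

/-- `y - x` is `(0, 1)` or `(-1, 0)`: a unit step rightwards or upwards. -/
def IsStep (x y : ℤ × ℤ) : Prop := y - x = (0, 1) ∨ y - x = (-1, 0)

/-- `w` is a path from `(a, β)` to `(α, b)` with unit steps rightwards or upwards. -/
structure IsPath (a b α β : ℕ) (w : List (ℤ × ℤ)) : Prop where
  start : w.head? = some ((a : ℤ), (β : ℤ))
  finish : w.getLast? = some ((α : ℤ), (b : ℤ))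
  steps : w.IsChain IsStep

/-- Paths `w` (the upper left one) and `w'` (the lower right one) are osculating: at each common
point `(i, j)`, the path `w` comes from the left and leaves upwards, while `w'` comes from below
(unless it starts there) and leaves to the right (unless it ends there). -/
def Osculating (w w' : List (ℤ × ℤ)) : Prop :=
  ∀ (m m' : ℕ) (i j : ℤ), w[m]? = some (i, j) → w'[m']? = some (i, j) →
    (m ≠ 0 ∧ w[m - 1]? = some (i, j - 1)) ∧
    w[m + 1]? = some (i - 1, j) ∧
    (m' ≠ 0 → w'[m' - 1]? = some (i + 1, j)) ∧
    (m' + 1 ≠ w'.length → w'[m' + 1]? = some (i, j + 1))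

/-- `OP(a, b, α, β)`: the tuples of osculating paths with boundary points `(α, β)`. -/
def OP (a b : ℕ) (p : BoundaryPair a b) : Set (Fin p.r → List (ℤ × ℤ)) :=
  {P | (∀ k, IsPath a b (p.alpha k) (p.beta k) (P k)) ∧
    ∀ k k' : Fin p.r, (k' : ℕ) = (k : ℕ) + 1 → Osculating (P k) (P k')}

/-- The vacancies of a path tuple: the points of the rectangle through which no path passes. -/
noncomputable def vacancies (a b : ℕ) {r : ℕ} (P : Fin r → List (ℤ × ℤ)) : Finset (ℤ × ℤ) :=
  (rect a b).filter fun x => ∀ k, x ∉ P k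

/-- The osculations of a path tuple: the points which are common to two different paths. -/
noncomputable def osculations (a b : ℕ) {r : ℕ} (P : Fin r → List (ℤ × ℤ)) : Finset (ℤ × ℤ) :=
  (rect a b).filter fun x => ∃ k k', k ≠ k' ∧ x ∈ P k ∧ x ∈ P k'

/-- The vacancy-osculation set `Z(P)`. -/
noncomputable def vacOscSet (a b : ℕ) {r : ℕ} (P : Fin r → List (ℤ × ℤ)) : Finset (ℤ × ℤ) :=
  vacancies a b P ∪ osculations a b P

/-- `VOS(a, b, α, β, l)`: the vacancy-osculation sets of size `l` with boundary points `(α, β)`. -/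
def VOS (a b : ℕ) (p : BoundaryPair a b) (l : ℕ) : Set (Finset (ℤ × ℤ)) :=
  vacOscSet a b '' {P | P ∈ OP a b p ∧ (vacOscSet a b P).card = l}

/-! ## Partitions

A partition is represented by its Young diagram. The cells of a `YoungDiagram` are numbered from
`(0, 0)` instead of `(1, 1)`, so that the content (column minus row) of a cell is unchanged. -/

lemma add_le_add_of_strictAnti {r : ℕ} {g : Fin r → ℕ} (hg : StrictAnti g) :
    Antitone fun k : Fin r => (k : ℕ) + g k := by
  cases r with
  | zero => exact fun k => k.elim0
  | succ n =>
    refine Fin.antitone_iff_succ_le.2 fun k => ?_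
    have := hg (Fin.castSucc_lt_succ (i := k))
    simp only [Fin.val_succ, Fin.val_castSucc]
    omega

/-- The partition with Frobenius notation `(γ_1, ..., γ_r | δ_1, ..., δ_r)`: it has `r` cells on the
main diagonal, `γ_k` cells to the right of the `k`-th of these, and `δ_k` cells below it. -/
def frobenius {r : ℕ} (γ δ : Fin r → ℕ) (hγ : StrictAnti γ) (hδ : StrictAnti δ) :
    YoungDiagram where
  cells := Finset.univ.biUnion fun k : Fin r =>
    ((Finset.range (γ k + 1)).image fun m => ((k : ℕ), (k : ℕ) + m)) ∪
    ((Finset.range (δ k + 1)).image fun m => ((k : ℕ) + m, (k : ℕ)))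
  isLowerSet := by
    have hg := add_le_add_of_strictAnti hγ
    have hd := add_le_add_of_strictAnti hδ
    rintro ⟨i, j⟩ ⟨i', j'⟩ ⟨hi, hj⟩ h
    simp only [Finset.coe_biUnion, Set.mem_iUnion, Finset.mem_coe, Finset.mem_union,
      Finset.mem_image, Finset.mem_range, Prod.mk.injEq, Finset.mem_univ, exists_prop,
      true_and] at h ⊢
    simp only at hi hj
    obtain ⟨k, hk⟩ := h
    have hkr := k.2
    have hmin : min i' j' ≤ (k : ℕ) := by
      rcases hk with ⟨m, -, h1, h2⟩ | ⟨m, -, h1, h2⟩ <;> omega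
    have hKr : min i' j' < r := by omega
    have hgk := hg (show (⟨min i' j', hKr⟩ : Fin r) ≤ k from hmin)
    have hdk := hd (show (⟨min i' j', hKr⟩ : Fin r) ≤ k from hmin)
    dsimp only at hgk hdk
    refine ⟨⟨min i' j', hKr⟩, ?_⟩
    dsimp only
    generalize γ ⟨min i' j', hKr⟩ = x at *
    generalize δ ⟨min i' j', hKr⟩ = y at *
    rcases le_total i' j' with h' | h'
    · refine Or.inl ⟨j' - i', ?_, ?_, ?_⟩ <;>
        rcases hk with ⟨m, hm, h1, h2⟩ | ⟨m, hm, h1, h2⟩ <;> omega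
    · refine Or.inr ⟨i' - j', ?_, ?_, ?_⟩ <;>
        rcases hk with ⟨m, hm, h1, h2⟩ | ⟨m, hm, h1, h2⟩ <;> omega

/-- The `(a, b)`-complement `(b - μ_a, b - μ_{a-1}, ..., b - μ_1)` of a partition `μ` whose diagram
fits into the `a` by `b` rectangle. -/
def complement (a b : ℕ) (μ : YoungDiagram) : YoungDiagram where
  cells := (Finset.range a ×ˢ Finset.range b).filter fun c => c.2 < b - μ.rowLen (a - 1 - c.1)
  isLowerSet := by
    rintro ⟨i, j⟩ ⟨i', j'⟩ ⟨hi, hj⟩ h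
    simp only [Finset.coe_filter, Finset.mem_product, Finset.mem_range, Set.mem_ofPred_eq] at h ⊢
    simp only at hi hj
    have := μ.rowLen_anti (a - 1 - i) (a - 1 - i') (by omega)
    omega

/-- The partition `λ_{a,b,α,β}`, which is the `(a, b)`-complement of
`(b - β_1, ..., b - β_r | a - α_1, ..., a - α_r)`. -/
def BoundaryPair.partition {a b : ℕ} (p : BoundaryPair a b) : YoungDiagram :=
  complement a b (frobenius (fun k => b - p.beta k) (fun k => a - p.alpha k)
    (fun k k' h => by
      have h1 := p.beta.strictMono h
      have h2 := (Finset.mem_Icc.1 (p.cols_subset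
        (Finset.orderEmbOfFin_mem p.cols p.card_eq.symm k'))).2
      simp only [BoundaryPair.beta] at h1 h2 ⊢
      omega)
    (fun k k' h => by
      have h1 := p.alpha.strictMono h
      have h2 := (Finset.mem_Icc.1 (p.rows_subset
        (Finset.orderEmbOfFin_mem p.rows rfl k'))).2
      simp only [BoundaryPair.alpha] at h1 h2 ⊢
      omega))

/-- Partitions differ by a square: one of the two Young diagrams is the disjoint union of the other
one and a single square. -/
def DifferBySquare (μ ν : YoungDiagram) : Prop := ∃ c, symmDiff μ.cells ν.cells = {c}

/-- The diagonal difference of partitions which differ by a square: the content of that square.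
(The sum has just one term in this case.) -/
def diagDiff (μ ν : YoungDiagram) : ℤ :=
  ∑ c ∈ symmDiff μ.cells ν.cells, ((c.2 : ℤ) - (c.1 : ℤ))

/-! ## Oscillating tableaux -/

/-- `OT(μ, l)`: the oscillating tableaux of shape `μ` and length `l`. -/
def OT (μ : YoungDiagram) (l : ℕ) : Set (Fin (l + 1) → YoungDiagram) :=
  {η | η 0 = ⊥ ∧ η (Fin.last l) = μ ∧ ∀ k : Fin l, DifferBySquare (η k.castSucc) (η k.succ)}

/-- The profile `Ω(η)` of an oscillating tableau. -/
def profile {l : ℕ} (η : Fin (l + 1) → YoungDiagram) (k : Fin l) : ℤ :=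
  diagDiff (η k.castSucc) (η k.succ)

/-- `GOT(T, ≺, μ, l)`: the generalized oscillating tableaux. -/
def GOT (T : Set ℤ) (prec : ℤ → ℤ → Prop) (μ : YoungDiagram) (l : ℕ) :
    Set ((Fin l → ℤ) × (Fin (l + 1) → YoungDiagram)) :=
  {x | (∀ k, x.1 k ∈ T) ∧ x.2 ∈ OT μ l ∧
    ∀ k k' : Fin l, (k' : ℕ) = (k : ℕ) + 1 →
      x.1 k < x.1 k' ∨ (x.1 k = x.1 k' ∧ prec (profile x.2 k) (profile x.2 k'))}

/-! ## Ordering pairs and the induced mapping -/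

/-- `L` (used only on points with positive coordinates) and the total strict order `prec` on `ℤ` form
an ordering pair. -/
structure IsOrderingPair (L : ℤ × ℤ → ℤ) (prec : ℤ → ℤ → Prop) : Prop where
  strictTotal : IsStrictTotalOrder ℤ prec
  pos : ∀ i j : ℤ, 1 ≤ i → 1 ≤ j → 1 ≤ L (i, j)
  order : ∀ i j i' j' : ℤ, 1 ≤ i → 1 ≤ j → 1 ≤ i' → 1 ≤ j' →
    (L (i, j) < L (i', j') ∨ (L (i, j) = L (i', j') ∧ prec (j - i) (j' - i'))) →
    i < i' ∨ j < j'

/-- `s` is the progression for `S` induced by `(L, ≺)`: it is an ordering of `S` which is canonical,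
and its terms increase with respect to the level and then, for equal levels, the content. -/
structure IsInducedProgression (L : ℤ × ℤ → ℤ) (prec : ℤ → ℤ → Prop) (S : Finset (ℤ × ℤ)) {l : ℕ}
    (s : Fin l → ℤ × ℤ) : Prop where
  injective : Function.Injective s
  image_eq : Finset.univ.image s = S
  canonical : ∀ k k' : Fin l, k < k' → (s k).1 < (s k').1 ∨ (s k).2 < (s k').2
  increasing : ∀ k k' : Fin l, (k' : ℕ) = (k : ℕ) + 1 →
    L (s k) < L (s k') ∨
      (L (s k) = L (s k') ∧ prec ((s k).2 - (s k).1) ((s k').2 - (s k').1))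

/-- `η` is the oscillating tableau associated with `s`: its profile is the sequence of contents
of `s`. -/
def IsAssociatedTableau {l : ℕ} (s : Fin l → ℤ × ℤ) (η : Fin (l + 1) → YoungDiagram) : Prop :=
  (∃ μ, η ∈ OT μ l) ∧ ∀ k, profile η k = (s k).2 - (s k).1

/-- The progression of length `l` for `S` induced by `(L, ≺)`. -/
noncomputable def inducedProgression (L : ℤ × ℤ → ℤ) (prec : ℤ → ℤ → Prop) (l : ℕ)
    (S : Finset (ℤ × ℤ)) : Fin l → ℤ × ℤ :=
  Classical.epsilon fun s => IsInducedProgression L prec S s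

/-- The oscillating tableau associated with a progression `s`. -/
noncomputable def associatedTableau {l : ℕ} (s : Fin l → ℤ × ℤ) : Fin (l + 1) → YoungDiagram :=
  Classical.epsilon fun η => IsAssociatedTableau s η

/-- The mapping `Θ` induced by `(L, ≺)`, on vacancy-osculation sets of size `l`. -/
noncomputable def Theta (L : ℤ × ℤ → ℤ) (prec : ℤ → ℤ → Prop) (l : ℕ) (S : Finset (ℤ × ℤ)) :
    (Fin l → ℤ) × (Fin (l + 1) → YoungDiagram) :=
  (fun k => L (inducedProgression L prec l S k), associatedTableau (inducedProgression L prec l S))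

/-- The level function `L_q`. -/
def level (q : ℤ) (x : ℤ × ℤ) : ℤ :=
  if q ≤ 0 then max (x.1 + q) x.2 else max x.1 (x.2 - q)

/-- The point `G_q(u, z)`. -/
def pointOf (q u z : ℤ) : ℤ × ℤ :=
  if q ≤ min 0 z then (u - z, u)
  else if z ≤ q ∧ q ≤ 0 then (u - q, u - q + z)
  else if 0 ≤ q ∧ q ≤ z then (u + q - z, u + q)
  else (u, u + z)

/-- The mapping `Φ_q`. -/
def Phi (q : ℤ) {l : ℕ} (x : (Fin l → ℤ) × (Fin (l + 1) → YoungDiagram)) : Finset (ℤ × ℤ) :=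
  Finset.univ.image fun k => pointOf q (x.1 k) (profile x.2 k)

end OsculatingPaths

namespace OsculatingPaths

/-! ## Edge functions of Young diagrams -/

/-! A Young diagram is encoded by its edge function, which records where each diagonal leaves the
diagram. Edge functions are the `StepDown` functions that agree with `max 0 (-z)` far out, and
adding or removing a square of content `z` changes the value at `z` by one. An oscillating tableau
is thus a sequence of unit changes that preserves `StepDown`. The sign of each change is forced, so
the profile determines the tableau (`eq_of_profile_eq`).

A tuple of osculating paths is encoded by its corner sum: `N x y` is the number of paths through
`[x] × [y]`, and the `k`-th path is recovered as the boundary of the region `N > k` (`mem_VOS_iff`).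
Along a diagonal, `N` grows at each point by the number of paths through it, which is 0, 1 or 2.
Hence `x - N x y` changes exactly on the vacancy-osculation set, by `+1` at a vacancy and `-1` at an
osculation.

Now list this set in a canonical order and apply these changes one by one to the edge function of
the empty partition. Every corner `(x, y)` has a moment at which the contents `y - x - 1`, `y - x`,
`y - x + 1` carry the values of "row minus `N`" at `(x, y - 1)`, `(x, y)`, `(x - 1, y)`. `StepDown`
there says that `N` has unit steps in both directions, and the boundary values of `N` prescribed by
`α` and `β` are the edge function of `λ`. This is `exists_isCornerSum_iff`.

The rest concerns order. Level and content are coordinates on the lattice with inverse `pointOf`, so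
`Theta` records the points in sorted order and `Phi` reads them back. It remains to see that `Phi`
stays in the rectangle (`profile_bounds_of_mem_GOT`): a content is reached only after a neighbour
nearer to zero, and an ordering pair forbids certain such outward moves within one level. -/

/-- The function `E` is nonincreasing and drops by at most one at each step. -/
def StepDown (E : ℤ → ℤ) : Prop := ∀ z, E (z + 1) ≤ E z ∧ E z ≤ E (z + 1) + 1

lemma StepDown.antitone {E : ℤ → ℤ} (h : StepDown E) : Antitone E :=
  antitone_int_of_succ_le fun z => (h z).1

lemma StepDown.monotone_add {E : ℤ → ℤ} (h : StepDown E) : Monotone fun z => E z + z :=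
  monotone_int_of_le_succ fun z => by have := (h z).2; omega

lemma stepDown_max_neg : StepDown fun z => max 0 (-z) := fun z => by dsimp only; omega

lemma exists_diag_notMem (μ : YoungDiagram) (z : ℤ) :
    ∃ m : ℕ, (m + (-z).toNat, m + z.toNat) ∉ μ := by
  by_contra! h
  have hinj : Function.Injective fun m : ℕ => (m + (-z).toNat, m + z.toNat) := fun m n hmn => by
    have := (Prod.mk.inj hmn).1
    omega
  exact Set.infinite_range_of_injective hinj
    (μ.cells.finite_toSet.subset (by rintro _ ⟨m, rfl⟩; exact (h m)))

open Classical in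
/-- The row (numbered from zero) of the first point with content `z` outside the diagram. -/
noncomputable def edge (μ : YoungDiagram) (z : ℤ) : ℤ :=
  max 0 (-z) + Nat.find (exists_diag_notMem μ z)

lemma le_edge (μ : YoungDiagram) (z : ℤ) : max 0 (-z) ≤ edge μ z := by
  unfold edge
  omega

lemma mem_iff_lt_edge (μ : YoungDiagram) (i j : ℕ) :
    (i, j) ∈ μ ↔ (i : ℤ) < edge μ ((j : ℤ) - i) := by
  classical
  have key : ∀ m : ℕ, (m + (-((j : ℤ) - i)).toNat, m + ((j : ℤ) - i).toNat) ∈ μ ↔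
      m < Nat.find (exists_diag_notMem μ ((j : ℤ) - i)) := by
    intro m
    rw [Nat.lt_find_iff]
    constructor
    · intro h n hn hn'
      exact hn' (μ.up_left_mem (by omega) (by omega) h)
    · intro h
      simpa using h m le_rfl
  have h := key (min i j)
  rw [show min i j + (-((j : ℤ) - i)).toNat = i by omega,
    show min i j + ((j : ℤ) - i).toNat = j by omega] at h
  rw [h, edge]
  omega

lemma eq_of_forall_lt_iff {m A B : ℤ} (hA : m ≤ A) (hB : m ≤ B)
    (h : ∀ i, m ≤ i → (i < A ↔ i < B)) : A = B := by
  have h1 := h A hA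
  have h2 := h B hB
  omega

lemma edge_eq_of_mem_iff {μ : YoungDiagram} {z e : ℤ} (he : max 0 (-z) ≤ e)
    (h : ∀ i j : ℕ, (j : ℤ) - i = z → ((i, j) ∈ μ ↔ (i : ℤ) < e)) : edge μ z = e := by
  refine eq_of_forall_lt_iff (le_edge μ z) he fun i hi => ?_
  obtain ⟨m, rfl⟩ := Int.eq_ofNat_of_zero_le (show 0 ≤ i by omega)
  obtain ⟨n, hn⟩ := Int.eq_ofNat_of_zero_le (show 0 ≤ m + z by omega)
  rw [← h m n (by omega), mem_iff_lt_edge, show (n : ℤ) - m = z by omega]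

lemma stepDown_edge (μ : YoungDiagram) : StepDown (edge μ) := by
  intro z
  have h1 := le_edge μ z
  have h2 := le_edge μ (z + 1)
  constructor
  · by_contra! h
    obtain ⟨i, hi⟩ := Int.eq_ofNat_of_zero_le (show 0 ≤ edge μ z by omega)
    obtain ⟨j, hj⟩ := Int.eq_ofNat_of_zero_le (show 0 ≤ edge μ z + z by omega)
    have h3 : (i, j + 1) ∈ μ := by
      rw [mem_iff_lt_edge, show ((j + 1 : ℕ) : ℤ) - i = z + 1 by push_cast; omega]
      omega
    have h4 := μ.up_left_mem le_rfl (Nat.le_succ j) h3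
    rw [mem_iff_lt_edge, show (j : ℤ) - i = z by omega] at h4
    omega
  · by_contra! h
    obtain ⟨i, hi⟩ := Int.eq_ofNat_of_zero_le (show 0 ≤ edge μ (z + 1) by omega)
    obtain ⟨j, hj⟩ := Int.eq_ofNat_of_zero_le (show 0 ≤ edge μ (z + 1) + (z + 1) by omega)
    have h3 : (i + 1, j) ∈ μ := by
      rw [mem_iff_lt_edge, show (j : ℤ) - ((i + 1 : ℕ) : ℤ) = z by push_cast; omega]
      push_cast
      omega
    have h4 := μ.up_left_mem (Nat.le_succ i) le_rfl h3
    rw [mem_iff_lt_edge, show (j : ℤ) - i = z + 1 by omega] at h4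
    omega

lemma edge_injective : Function.Injective edge := by
  intro μ ν h
  ext ⟨i, j⟩
  rw [YoungDiagram.mem_cells, YoungDiagram.mem_cells, mem_iff_lt_edge, mem_iff_lt_edge, h]

lemma edge_bot (z : ℤ) : edge ⊥ z = max 0 (-z) :=
  edge_eq_of_mem_iff le_rfl fun i j h => by
    simp only [YoungDiagram.notMem_bot, false_iff]
    omega

/-- Every step function with the appropriate limiting behaviour is the edge function of a Young
diagram. -/
lemma exists_edge_eq {E : ℤ → ℤ} (hE : StepDown E) {n : ℤ}
    (hl : ∀ z, z ≤ -n → E z = max 0 (-z)) (hr : ∀ z, n ≤ z → E z = max 0 (-z)) :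
    ∃ μ, edge μ = E := by
  classical
  -- For negative `n` the hypotheses cover all `z`, so `n = 0` serves as well.
  wlog hn : 0 ≤ n generalizing n
  · exact this (n := 0) (fun z hz => hl z (by omega)) (fun z hz => hr z (by omega)) le_rfl
  have hlow : ∀ i j i' j' : ℤ, i' ≤ i → j' ≤ j → i < E (j - i) → i' < E (j' - i') := by
    intro i j i' j' hi hj h
    have h1 := hE.monotone_add (show j - i ≤ j - i' by omega)
    have h2 := hE.antitone (show j' - i' ≤ j - i' by omega)
    dsimp only at h1
    omega
  have hge : ∀ z, max 0 (-z) ≤ E z := by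
    intro z
    have h1 := hE.antitone (show z ≤ max z n by omega)
    have h2 := hE.monotone_add (show min z (-n) ≤ z by omega)
    have h3 := hr (max z n) (by omega)
    have h4 := hl (min z (-n)) (by omega)
    dsimp only at h2
    omega
  have hbd : ∀ i j : ℕ, (i : ℤ) < E (j - i) → (i : ℤ) < n ∧ (j : ℤ) < n := by
    intro i j h
    have h0 : -n ≤ (j : ℤ) - i := by
      by_contra! h'
      have := hl _ h'.le
      omega
    have h0' : (j : ℤ) - i ≤ n := by
      by_contra! h'
      have := hr _ h'.le
      omega
    have h1 := hE.antitone h0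
    have h2 := hE.monotone_add h0'
    have h3 := hr n le_rfl
    have h4 := hl (-n) le_rfl
    dsimp only at h2
    omega
  let μ : YoungDiagram :=
    { cells := (Finset.range n.toNat ×ˢ Finset.range n.toNat).filter
        fun c => (c.1 : ℤ) < E ((c.2 : ℤ) - c.1)
      isLowerSet := by
        rintro ⟨i, j⟩ ⟨i', j'⟩ ⟨hi, hj⟩ h
        simp only [Finset.coe_filter, Finset.mem_product, Finset.mem_range,
          Set.mem_ofPred_eq] at h ⊢
        simp only at hi hj
        have h1 := hlow i j i' j' (by omega) (by omega) h.2
        omega }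
  have hμ : ∀ i j : ℕ, (i, j) ∈ μ ↔ (i : ℤ) < E ((j : ℤ) - i) := by
    intro i j
    rw [← YoungDiagram.mem_cells]
    simp only [μ, Finset.mem_filter, Finset.mem_product, Finset.mem_range]
    refine ⟨fun h => h.2, fun h => ⟨?_, h⟩⟩
    have := hbd i j h
    omega
  refine ⟨μ, funext fun z => edge_eq_of_mem_iff (hge z) fun i j h => ?_⟩
  rw [hμ, h]

/-- The new square must be the first point of its diagonal outside `μ`: `ν` is a lower set, so it
contains that first point, and this can only be the new square. -/
lemma edge_of_cells_eq_insert {μ ν : YoungDiagram} {i j : ℕ} (hc : (i, j) ∉ μ)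
    (h : ∀ c, c ∈ ν ↔ c = (i, j) ∨ c ∈ μ) :
    edge ν = edge μ + Pi.single ((j : ℤ) - i) 1 := by
  have hstep : edge μ ((j : ℤ) - i) = i := by
    rw [mem_iff_lt_edge] at hc
    have hle := le_edge μ ((j : ℤ) - i)
    by_contra hne
    obtain ⟨i', hi'⟩ := Int.eq_ofNat_of_zero_le (show 0 ≤ edge μ ((j : ℤ) - i) by omega)
    obtain ⟨j', hj'⟩ := Int.eq_ofNat_of_zero_le (show 0 ≤ edge μ ((j : ℤ) - i) + (j - i) by omega)
    have h1 : (i', j') ∈ ν :=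
      ν.up_left_mem (by omega) (by omega) ((h (i, j)).2 (Or.inl rfl))
    rcases (h _).1 h1 with h2 | h2
    · have := (Prod.mk.inj h2).1
      omega
    · rw [mem_iff_lt_edge, show (j' : ℤ) - i' = j - i by omega] at h2
      omega
  funext z
  refine edge_eq_of_mem_iff ?_ fun i' j' hz => ?_
  · have := le_edge μ z
    by_cases hz : z = (j : ℤ) - i <;> simp [hz] at this ⊢ <;> omega
  · rw [h, mem_iff_lt_edge, hz, Prod.mk.injEq]
    by_cases hz' : z = (j : ℤ) - i
    · subst hz'
      simp only [Pi.add_apply, Pi.single_eq_same]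
      omega
    · simp only [Pi.add_apply, Pi.single_eq_of_ne hz', add_zero]
      omega

lemma symmDiff_cells_eq_singleton {μ ν : YoungDiagram} {c : ℕ × ℕ}
    (h : symmDiff μ.cells ν.cells = {c}) :
    (c ∉ μ ∧ ∀ x, x ∈ ν ↔ x = c ∨ x ∈ μ) ∨ (c ∉ ν ∧ ∀ x, x ∈ μ ↔ x = c ∨ x ∈ ν) := by
  have hx : ∀ x, (x ∈ μ ∧ x ∉ ν ∨ x ∈ ν ∧ x ∉ μ) ↔ x = c := by
    intro x
    have := Finset.ext_iff.1 h x
    simpa [Finset.mem_symmDiff] using this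
  rcases (hx c).2 rfl with ⟨h1, h2⟩ | ⟨h1, h2⟩
  · right
    refine ⟨h2, fun x => ?_⟩
    by_cases hxc : x = c
    · simp [hxc, h1]
    · have := (hx x).not.2 hxc
      tauto
  · left
    refine ⟨h2, fun x => ?_⟩
    by_cases hxc : x = c
    · simp [hxc, h1]
    · have := (hx x).not.2 hxc
      tauto

/-- Partitions which differ by a square have edge functions differing by one at its content. -/
lemma DifferBySquare.edge_eq {μ ν : YoungDiagram} (h : DifferBySquare μ ν) :
    ∃ ε : ℤ, (ε = 1 ∨ ε = -1) ∧ edge ν = edge μ + Pi.single (diagDiff μ ν) ε := by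
  obtain ⟨⟨i, j⟩, hc⟩ := h
  have hd : diagDiff μ ν = (j : ℤ) - i := by simp [diagDiff, hc]
  rw [hd]
  rcases symmDiff_cells_eq_singleton hc with ⟨h1, h2⟩ | ⟨h1, h2⟩
  · exact ⟨1, Or.inl rfl, edge_of_cells_eq_insert h1 h2⟩
  · refine ⟨-1, Or.inr rfl, ?_⟩
    rw [edge_of_cells_eq_insert h1 h2, add_assoc, ← Pi.single_add]
    simp

lemma differBySquare_of_edge_eq {μ ν : YoungDiagram} {z ε : ℤ} (hε : ε = 1 ∨ ε = -1)
    (h : edge ν = edge μ + Pi.single z ε) : DifferBySquare μ ν ∧ diagDiff μ ν = z := by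
  have hz : edge ν z = edge μ z + ε := by simp [h]
  have hz' : ∀ w, w ≠ z → edge ν w = edge μ w := fun w hw => by simp [h, hw]
  have h1 := le_edge μ z
  have h2 := le_edge ν z
  -- The square lies in the row given by the smaller of the two edge values, on the diagonal `z`.
  obtain ⟨i, hi⟩ := Int.eq_ofNat_of_zero_le (show 0 ≤ min (edge μ z) (edge ν z) by omega)
  obtain ⟨j, hj⟩ := Int.eq_ofNat_of_zero_le (show 0 ≤ min (edge μ z) (edge ν z) + z by omega)
  have hc : symmDiff μ.cells ν.cells = {(i, j)} := by
    ext ⟨i', j'⟩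
    simp only [Finset.mem_symmDiff, YoungDiagram.mem_cells, Finset.mem_singleton, Prod.mk.injEq,
      mem_iff_lt_edge]
    by_cases hw : (j' : ℤ) - i' = z
    · rw [hw]
      omega
    · rw [hz' _ hw]
      omega
  refine ⟨⟨_, hc⟩, ?_⟩
  simp only [diagDiff, hc, Finset.sum_singleton]
  omega

/-- The value at `z + 1` is untouched, and `StepDown` leaves only two adjacent values at `z`. A
change by `+1` and a change by `-1` would give values two apart, so the sign is forced. -/
lemma eq_of_diagDiff_eq {μ ν ν' : YoungDiagram} (h : DifferBySquare μ ν)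
    (h' : DifferBySquare μ ν') (hd : diagDiff μ ν = diagDiff μ ν') : ν = ν' := by
  obtain ⟨ε, hε, he⟩ := h.edge_eq
  obtain ⟨ε', hε', he'⟩ := h'.edge_eq
  apply edge_injective
  rw [he, he', hd]
  congr 2
  set z := diagDiff μ ν'
  rw [hd] at he
  have h1 : edge ν z = edge μ z + ε := by simp [he]
  have h1' : edge ν' z = edge μ z + ε' := by simp [he']
  have h2 : edge ν (z + 1) = edge μ (z + 1) := by simp [he]
  have h2' : edge ν' (z + 1) = edge μ (z + 1) := by simp [he']
  have h3 := stepDown_edge ν z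
  have h3' := stepDown_edge ν' z
  omega

/-- An oscillating tableau is determined by its profile. -/
lemma eq_of_profile_eq {μ μ' : YoungDiagram} {l : ℕ} {η η' : Fin (l + 1) → YoungDiagram}
    (h : η ∈ OT μ l) (h' : η' ∈ OT μ' l) (hp : profile η = profile η') : η = η' := by
  funext k
  induction k using Fin.induction with
  | zero => rw [h.1, h'.1]
  | succ k ih =>
    have h1 := h.2.2 k
    have h2 := congrFun hp k
    unfold profile at h2
    rw [ih] at h1 h2
    exact eq_of_diagDiff_eq h1 (h'.2.2 k) h2

/-! ## The edge function of the partition of a boundary pair -/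

/-- The number of elements of `s` which are at most `y`. -/
def countLE (s : Finset ℕ) (y : ℤ) : ℤ := ((s.filter fun c : ℕ => (c : ℤ) ≤ y).card : ℤ)

lemma mem_iff_lt_card {r : ℕ} {s : Finset (Fin r)} (hs : ∀ k ∈ s, ∀ k' ≤ k, k' ∈ s) (k : Fin r) :
    k ∈ s ↔ (k : ℕ) < s.card := by
  constructor
  · intro hk
    have : (Finset.Iic k).card ≤ s.card :=
      Finset.card_le_card fun k' hk' => hs k hk k' (Finset.mem_Iic.1 hk')
    rw [Fin.card_Iic] at this
    omega
  · intro hk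
    by_contra hk'
    have : s.card ≤ (Finset.Iio k).card := Finset.card_le_card fun k' h' => by
      rw [Finset.mem_Iio]
      by_contra! h
      exact hk' (hs k' h' k h)
    rw [Fin.card_Iio] at this
    omega

lemma countLE_eq_card {r : ℕ} (s : Finset ℕ) (h : s.card = r) (y : ℤ) :
    countLE s y =
      ((Finset.univ.filter fun k : Fin r => (s.orderEmbOfFin h k : ℤ) ≤ y).card : ℤ) := by
  unfold countLE
  have := congrArg (fun t : Finset ℕ => (t.filter fun c : ℕ => (c : ℤ) ≤ y).card)
    (Finset.map_orderEmbOfFin_univ s h)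
  simp only [Finset.filter_map, Finset.card_map] at this
  rw [← this]
  rfl

/-- The indices of the elements up to `y` form an initial segment of `Fin r`, determined by its
size. -/
lemma orderEmbOfFin_le_iff {r : ℕ} (s : Finset ℕ) (h : s.card = r) (k : Fin r) (y : ℤ) :
    (s.orderEmbOfFin h k : ℤ) ≤ y ↔ (k : ℤ) < countLE s y := by
  rw [countLE_eq_card s h, Nat.cast_lt, ← mem_iff_lt_card]
  · simp
  · intro k hk k' hkk'
    have := (s.orderEmbOfFin h).monotone hkk'
    simp only [Finset.mem_filter, Finset.mem_univ, true_and] at hk ⊢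
    omega

lemma countLE_nonneg (s : Finset ℕ) (y : ℤ) : 0 ≤ countLE s y := Int.natCast_nonneg _

lemma countLE_le_card (s : Finset ℕ) (y : ℤ) : countLE s y ≤ s.card :=
  Nat.cast_le.2 (Finset.card_filter_le _ _)

lemma countLE_le {s : Finset ℕ} {n : ℕ} (hs : s ⊆ Finset.Icc 1 n) {y : ℤ} (hy : 0 ≤ y) :
    countLE s y ≤ y := by
  obtain ⟨m, rfl⟩ := Int.eq_ofNat_of_zero_le hy
  have : (s.filter fun c : ℕ => (c : ℤ) ≤ m) ⊆ Finset.Icc 1 m := fun c hc => by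
    simp only [Finset.mem_filter] at hc
    have := Finset.mem_Icc.1 (hs hc.1)
    rw [Finset.mem_Icc]
    omega
  have := Finset.card_le_card this
  simp only [Nat.card_Icc, add_tsub_cancel_right] at this
  exact Nat.cast_le.2 this

lemma mem_frobenius {r : ℕ} {γ δ : Fin r → ℕ} (hγ : StrictAnti γ) (hδ : StrictAnti δ) (i j : ℕ) :
    (i, j) ∈ frobenius γ δ hγ hδ ↔
      (∃ h : i < r, i ≤ j ∧ j - i ≤ γ ⟨i, h⟩) ∨ (∃ h : j < r, j ≤ i ∧ i - j ≤ δ ⟨j, h⟩) := by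
  rw [← YoungDiagram.mem_cells]
  simp only [frobenius, Finset.mem_biUnion, Finset.mem_univ, true_and, Finset.mem_union,
    Finset.mem_image, Finset.mem_range, Prod.mk.injEq]
  constructor
  · rintro ⟨k, ⟨m, hm, rfl, rfl⟩ | ⟨m, hm, rfl, rfl⟩⟩
    · exact Or.inl ⟨k.2, by omega, by simp only [Fin.eta]; omega⟩
    · exact Or.inr ⟨k.2, by omega, by simp only [Fin.eta]; omega⟩
  · rintro (⟨h, h1, h2⟩ | ⟨h, h1, h2⟩)
    · exact ⟨⟨i, h⟩, Or.inl ⟨j - i, by omega, rfl, by simp only; omega⟩⟩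
    · exact ⟨⟨j, h⟩, Or.inr ⟨i - j, by omega, by simp only; omega, rfl⟩⟩

lemma mem_complement (a b : ℕ) (μ : YoungDiagram) (i j : ℕ) :
    (i, j) ∈ complement a b μ ↔ i < a ∧ j < b ∧ (a - 1 - i, b - 1 - j) ∉ μ := by
  rw [← YoungDiagram.mem_cells]
  simp only [complement, Finset.mem_filter, Finset.mem_product, Finset.mem_range,
    YoungDiagram.mem_iff_lt_rowLen]
  omega

/-! ### Boundary values of the edge function of `λ` -/

namespace BoundaryPair

variable {a b : ℕ} (p : BoundaryPair a b)

lemma alpha_mem (k : Fin p.r) : 1 ≤ p.alpha k ∧ p.alpha k ≤ a :=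
  Finset.mem_Icc.1 (p.rows_subset (Finset.orderEmbOfFin_mem p.rows rfl k))

lemma beta_mem (k : Fin p.r) : 1 ≤ p.beta k ∧ p.beta k ≤ b :=
  Finset.mem_Icc.1 (p.cols_subset (Finset.orderEmbOfFin_mem p.cols p.card_eq.symm k))

lemma alpha_le_iff (k : Fin p.r) (x : ℤ) : (p.alpha k : ℤ) ≤ x ↔ (k : ℤ) < countLE p.rows x :=
  orderEmbOfFin_le_iff p.rows rfl k x

lemma beta_le_iff (k : Fin p.r) (y : ℤ) : (p.beta k : ℤ) ≤ y ↔ (k : ℤ) < countLE p.cols y :=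
  orderEmbOfFin_le_iff p.cols p.card_eq.symm k y

lemma r_le_left : p.r ≤ a := by
  simpa using Finset.card_le_card p.rows_subset

lemma r_le_right : p.r ≤ b := by
  have := Finset.card_le_card p.cols_subset
  rw [← p.card_eq] at this
  simpa using this

lemma countLE_rows_le (x : ℤ) : countLE p.rows x ≤ p.r := countLE_le_card _ _

lemma countLE_cols_le (y : ℤ) : countLE p.cols y ≤ p.r := by
  have := countLE_le_card p.cols y
  rwa [← p.card_eq] at this

lemma mem_partition (i j : ℕ) :
    (i, j) ∈ p.partition ↔ i < a ∧ j < b ∧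
      ¬((∃ h : a - 1 - i < p.r, a - 1 - i ≤ b - 1 - j ∧
          b - 1 - j - (a - 1 - i) ≤ b - p.beta ⟨a - 1 - i, h⟩) ∨
        (∃ h : b - 1 - j < p.r, b - 1 - j ≤ a - 1 - i ∧
          a - 1 - i - (b - 1 - j) ≤ a - p.alpha ⟨b - 1 - j, h⟩)) :=
  (mem_complement a b _ i j).trans
    (and_congr_right' (and_congr_right' (not_congr (mem_frobenius _ _ _ _))))

/-- Rotating the rectangle by a half turn sends these diagonals to those on or above the main
diagonal of the Frobenius diagram. Only the arms `b - β_k` matter there, and the arm condition in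
row `k` becomes `β_k ≤ a + (j - i)`. -/
lemma mem_partition_of_le {i j : ℕ} (hij : (j : ℤ) - i ≤ b - a) :
    (i, j) ∈ p.partition ↔ (i : ℤ) < a - countLE p.cols (a + (j - i)) := by
  have h0 := countLE_nonneg p.cols (a + (j - i))
  have h1 := p.countLE_cols_le (a + (j - i))
  rw [mem_partition]
  by_cases hi : i < a
  · have hj : j < b := by omega
    have hmem : ((∃ h : a - 1 - i < p.r, a - 1 - i ≤ b - 1 - j ∧
          b - 1 - j - (a - 1 - i) ≤ b - p.beta ⟨a - 1 - i, h⟩) ∨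
        (∃ h : b - 1 - j < p.r, b - 1 - j ≤ a - 1 - i ∧
          a - 1 - i - (b - 1 - j) ≤ a - p.alpha ⟨b - 1 - j, h⟩)) ↔
        ((a - 1 - i : ℕ) : ℤ) < countLE p.cols (a + (j - i)) := by
      constructor
      · rintro (⟨h, h1, h2⟩ | ⟨h, h1, h2⟩)
        · have := p.beta_mem ⟨_, h⟩
          have h3 := p.beta_le_iff ⟨_, h⟩ (a + (j - i))
          exact h3.1 (by omega)
        · have h4 : b - 1 - j = a - 1 - i := by omega
          rw [h4] at h
          have := p.beta_mem ⟨_, h⟩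
          have h3 := p.beta_le_iff ⟨_, h⟩ (a + (j - i))
          exact h3.1 (by omega)
      · intro h
        have h3 : a - 1 - i < p.r := by omega
        have := p.beta_mem ⟨_, h3⟩
        have h4 := (p.beta_le_iff ⟨_, h3⟩ (a + (j - i))).2 h
        exact Or.inl ⟨h3, by omega, by omega⟩
    rw [hmem]
    omega
  · omega

/-- As in `mem_partition_of_le`, with the legs `a - α_k` in place of the arms. -/
lemma mem_partition_of_ge {i j : ℕ} (hij : (b : ℤ) - a ≤ j - i) :
    (i, j) ∈ p.partition ↔ (i : ℤ) < (b - (j - i)) - countLE p.rows (b - (j - i)) := by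
  have h0 := countLE_nonneg p.rows (b - (j - i))
  have h1 := p.countLE_rows_le (b - (j - i))
  rw [mem_partition]
  by_cases hj : j < b
  · have hi : i < a := by omega
    have hmem : ((∃ h : a - 1 - i < p.r, a - 1 - i ≤ b - 1 - j ∧
          b - 1 - j - (a - 1 - i) ≤ b - p.beta ⟨a - 1 - i, h⟩) ∨
        (∃ h : b - 1 - j < p.r, b - 1 - j ≤ a - 1 - i ∧
          a - 1 - i - (b - 1 - j) ≤ a - p.alpha ⟨b - 1 - j, h⟩)) ↔
        ((b - 1 - j : ℕ) : ℤ) < countLE p.rows (b - (j - i)) := by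
      constructor
      · rintro (⟨h, h1, h2⟩ | ⟨h, h1, h2⟩)
        · have h4 : a - 1 - i = b - 1 - j := by omega
          rw [h4] at h
          have := p.alpha_mem ⟨_, h⟩
          have h3 := p.alpha_le_iff ⟨_, h⟩ (b - (j - i))
          exact h3.1 (by omega)
        · have := p.alpha_mem ⟨_, h⟩
          have h3 := p.alpha_le_iff ⟨_, h⟩ (b - (j - i))
          exact h3.1 (by omega)
      · intro h
        have h3 : b - 1 - j < p.r := by omega
        have := p.alpha_mem ⟨_, h3⟩
        have h4 := (p.alpha_le_iff ⟨_, h3⟩ (b - (j - i))).2 h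
        exact Or.inr ⟨h3, by omega, by omega⟩
    rw [hmem]
    omega
  · omega

/-- This is the value of `x - N x y` at the corner `(a, y)` of the lower boundary, for any corner
sum `N`. -/
lemma edge_partition_bottom {y : ℤ} (hy : 0 ≤ y) (hyb : y ≤ b) :
    edge p.partition (y - a) = a - countLE p.cols y := by
  have h1 := countLE_le p.cols_subset hy
  have h2 := p.countLE_cols_le y
  have h3 := p.r_le_left
  refine edge_eq_of_mem_iff (by omega) fun i j h => ?_
  rw [p.mem_partition_of_le (by omega), show (a : ℤ) + (j - i) = y by omega]

lemma edge_partition_right {x : ℤ} (hx : 0 ≤ x) (hxa : x ≤ a) :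
    edge p.partition (b - x) = x - countLE p.rows x := by
  have h1 := countLE_le p.rows_subset hx
  have h2 := p.countLE_rows_le x
  have h3 := p.r_le_right
  have h4 : countLE p.rows (b - (b - x)) = countLE p.rows x := by rw [sub_sub_cancel]
  have h5 : x - countLE p.rows x ≥ x - b := by omega
  refine edge_eq_of_mem_iff (by omega) fun i j h => ?_
  rw [p.mem_partition_of_ge (by omega), show (b : ℤ) - (j - i) = x by omega]

lemma edge_partition_of_lt {z : ℤ} (hz : z < -a ∨ b < z) : edge p.partition z = max 0 (-z) := by
  refine edge_eq_of_mem_iff le_rfl fun i j h => ?_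
  rw [mem_partition]
  omega

end BoundaryPair

/-! ## Corner sum functions -/

/-- Corner sum functions of edge configurations on the `a` by `b` rectangle: `N x y` is the number of
paths which pass through the block `[x] × [y]`. -/
structure IsCornerSum {a b : ℕ} (p : BoundaryPair a b) (N : ℤ → ℤ → ℤ) : Prop where
  top : ∀ y : ℤ, 0 ≤ y → y ≤ b → N 0 y = 0
  left : ∀ x : ℤ, 0 ≤ x → x ≤ a → N x 0 = 0
  row_step : ∀ x y : ℤ, 1 ≤ x → x ≤ a → 0 ≤ y → y ≤ b → N (x - 1) y ≤ N x y ∧ N x y ≤ N (x - 1) y + 1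
  col_step : ∀ x y : ℤ, 0 ≤ x → x ≤ a → 1 ≤ y → y ≤ b → N x (y - 1) ≤ N x y ∧ N x y ≤ N x (y - 1) + 1
  bottom : ∀ y : ℤ, 0 ≤ y → y ≤ b → N a y = countLE p.cols y
  right : ∀ x : ℤ, 0 ≤ x → x ≤ a → N x b = countLE p.rows x

/-- The vacancies and osculations of the edge configuration with corner sum function `N`. -/
noncomputable def cornerVacOsc (a b : ℕ) (N : ℤ → ℤ → ℤ) : Finset (ℤ × ℤ) :=
  (rect a b).filter fun x => N x.1 x.2 ≠ N (x.1 - 1) (x.2 - 1) + 1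

lemma mem_rect {a b : ℕ} {x : ℤ × ℤ} :
    x ∈ rect a b ↔ (1 ≤ x.1 ∧ x.1 ≤ a) ∧ 1 ≤ x.2 ∧ x.2 ≤ b := by
  simp [rect]

/-! ## Oscillating tableaux and corner sum functions -/

section Heights

variable {l : ℕ} (s : Fin l → ℤ × ℤ) (ε : Fin l → ℤ)

/-- The edge function after the first `k` steps, where step `m` changes the edge function by `ε m`
at the content of `s m`. -/
def partialEdge (k : ℕ) (z : ℤ) : ℤ :=
  max 0 (-z) + ∑ m : Fin l, if (m : ℕ) < k ∧ (s m).2 - (s m).1 = z then ε m else 0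

/-- The edge function at the content of the corner `(x, y)`, after the steps at the points of the
block `[x] × [y]`. -/
def cornerEdge (x y : ℤ) : ℤ :=
  max 0 (x - y) + ∑ m : Fin l, if (s m).2 - (s m).1 = y - x ∧ (s m).1 ≤ x then ε m else 0

lemma partialEdge_zero (z : ℤ) : partialEdge s ε 0 z = max 0 (-z) := by simp [partialEdge]

lemma partialEdge_succ (k : Fin l) :
    partialEdge s ε ((k : ℕ) + 1) =
      partialEdge s ε k + Pi.single ((s k).2 - (s k).1) (ε k) := by
  funext z
  simp only [partialEdge, Pi.add_apply, add_assoc, add_right_inj]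
  rw [← sub_eq_iff_eq_add', ← Finset.sum_sub_distrib, Finset.sum_eq_single k]
  · by_cases h : z = (s k).2 - (s k).1
    · subst h
      simp
    · rw [Pi.single_eq_of_ne h]
      simp [Ne.symm h]
  · intro m _ hm
    have : (m : ℕ) ≠ k := fun h => hm (Fin.ext h)
    have h2 : (m : ℕ) < k + 1 ↔ (m : ℕ) < k := by omega
    simp [h2]
  · simp

lemma partialEdge_eq_cornerEdge {k : ℕ} {x y z : ℤ} (hz : y - x = z)
    (h : ∀ m, (s m).2 - (s m).1 = z → ((m : ℕ) < k ↔ (s m).1 ≤ x)) :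
    partialEdge s ε k z = cornerEdge s ε x y := by
  subst hz
  unfold partialEdge cornerEdge
  congr 1
  · omega
  · refine Finset.sum_congr rfl fun m _ => if_congr ?_ rfl rfl
    have := h m
    tauto

lemma cornerEdge_of_nonpos (hs : ∀ m, 1 ≤ (s m).1 ∧ 1 ≤ (s m).2) {x y : ℤ} (h : x ≤ 0 ∨ y ≤ 0) :
    cornerEdge s ε x y = max 0 (x - y) := by
  unfold cornerEdge
  rw [Finset.sum_eq_zero, add_zero]
  intro m _
  have := hs m
  rw [if_neg]
  omega

lemma cornerEdge_sub_one_eq {x y : ℤ} (h : ∀ m, s m ≠ (x, y)) :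
    cornerEdge s ε x y = cornerEdge s ε (x - 1) (y - 1) := by
  unfold cornerEdge
  congr 1
  · omega
  · refine Finset.sum_congr rfl fun m _ => if_congr ?_ rfl rfl
    have := h m
    rw [Ne, Prod.ext_iff] at this
    omega

lemma cornerEdge_apply (hs : Function.Injective s) (k : Fin l) :
    cornerEdge s ε (s k).1 (s k).2 = cornerEdge s ε ((s k).1 - 1) ((s k).2 - 1) + ε k := by
  unfold cornerEdge
  rw [show (s k).1 - 1 - ((s k).2 - 1) = (s k).1 - (s k).2 by ring,
    show (s k).2 - 1 - ((s k).1 - 1) = (s k).2 - (s k).1 by ring, add_assoc, add_right_inj,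
    ← sub_eq_iff_eq_add', ← Finset.sum_sub_distrib, Finset.sum_eq_single k]
  · simp
  · intro m _ hm
    have hne : s m ≠ s k := fun h => hm (hs h)
    rw [Ne, Prod.ext_iff] at hne
    rw [sub_eq_zero]
    exact if_congr (by omega) rfl rfl
  · simp

/-- The first `k` terms of `s` are cut from the others by the corner `c`. -/
def IsCut (k : ℕ) (c : ℤ × ℤ) : Prop := ∀ m, (s m ≤ c ∨ c ≤ s m) → ((m : ℕ) < k ↔ s m ≤ c)

variable {s}

/-- Every corner cuts off an initial part of a canonical sequence. -/
lemma exists_isCut (hcan : ∀ k k', k < k' → (s k).1 < (s k').1 ∨ (s k).2 < (s k').2)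
    (c : ℤ × ℤ) : ∃ k, IsCut s k c := by
  classical
  -- One more than the last index of a point below `c`. The supremum is 0 if there is none, as
  -- needed.
  refine ⟨(Finset.univ.filter fun m => s m ≤ c).sup fun m => (m : ℕ) + 1, fun m hm => ?_⟩
  constructor
  · intro h
    rw [Finset.lt_sup_iff] at h
    obtain ⟨m', hm', hlt⟩ := h
    simp only [Finset.mem_filter, Finset.mem_univ, true_and] at hm'
    rcases hm with hm | hm
    · exact hm
    · rcases (Nat.lt_succ_iff.1 hlt).lt_or_eq with h' | h'
      · have h1 := hcan m m' h'
        have h2 := hm'.trans hm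
        rw [Prod.le_def] at h2
        omega
      · rwa [Fin.ext h']
  · intro h
    exact Finset.lt_sup_iff.2 ⟨m, by simpa using h, Nat.lt_succ_self _⟩

/-- By canonicity no later point is `≤ s k` and no earlier point is `≥ s k`, so the moment just
after step `k` belongs to the corner `s k`. -/
lemma isCut_succ (hcan : ∀ k k', k < k' → (s k).1 < (s k').1 ∨ (s k).2 < (s k').2)
    (k : Fin l) : IsCut s ((k : ℕ) + 1) (s k) := by
  intro m hm
  rcases lt_trichotomy m k with h | rfl | h
  · have := hcan _ _ h
    rw [Prod.le_def, Prod.le_def] at *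
    constructor
    · intro
      omega
    · intro
      exact Nat.lt_succ_of_lt h
  · simp
  · have := hcan _ _ h
    have h' : (k : ℕ) < m := h
    rw [Prod.le_def, Prod.le_def] at *
    constructor
    · omega
    · omega

/-- Every point on the diagonal of `(x, y)` or on an adjacent one is comparable with `(x, y)`. So
the cut decides whether its step has already been made. -/
lemma IsCut.partialEdge_eq {k : ℕ} {x y : ℤ} (h : IsCut s k (x, y)) :
    partialEdge s ε k (y - x) = cornerEdge s ε x y ∧
    partialEdge s ε k (y - x + 1) = cornerEdge s ε (x - 1) y ∧
    partialEdge s ε k (y - x - 1) = cornerEdge s ε x (y - 1) := by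
  refine ⟨partialEdge_eq_cornerEdge s ε rfl fun m hm => ?_,
    partialEdge_eq_cornerEdge s ε (by ring) fun m hm => ?_,
    partialEdge_eq_cornerEdge s ε (by ring) fun m hm => ?_⟩ <;>
  · have := h m
    simp only [Prod.le_def] at this
    rw [this (by omega)]
    omega

variable {a b : ℕ} {p : BoundaryPair a b}

lemma partialEdge_last_eq (hs : ∀ m, s m ∈ rect a b) :
    (∀ y, partialEdge s ε l (y - a) = cornerEdge s ε a y) ∧
    (∀ x, partialEdge s ε l (b - x) = cornerEdge s ε x b) ∧
    ∀ z : ℤ, z < -a ∨ b < z → partialEdge s ε l z = max 0 (-z) := by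
  refine ⟨fun y => partialEdge_eq_cornerEdge s ε rfl fun m hm => ?_,
    fun x => partialEdge_eq_cornerEdge s ε rfl fun m hm => ?_, fun z hz => ?_⟩
  · have := mem_rect.1 (hs m)
    simp only [m.2, true_iff]
    omega
  · have := mem_rect.1 (hs m)
    simp only [m.2, true_iff]
    omega
  · unfold partialEdge
    rw [Finset.sum_eq_zero, add_zero]
    intro m _
    have := mem_rect.1 (hs m)
    rw [if_neg]
    omega

/-- The existence of an oscillating tableau with given profile, in terms of edge functions. -/
lemma exists_mem_OT_iff (μ : YoungDiagram) :
    (∃ η ∈ OT μ l, ∀ k, profile η k = (s k).2 - (s k).1) ↔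
      ∃ ε : Fin l → ℤ, (∀ k, ε k = 1 ∨ ε k = -1) ∧ (∀ k ≤ l, StepDown (partialEdge s ε k)) ∧
        partialEdge s ε l = edge μ := by
  constructor
  · rintro ⟨η, ⟨h0, hl, hη⟩, hp⟩
    choose ε hε he using fun k => (hη k).edge_eq
    have key : ∀ k : Fin (l + 1), partialEdge s ε k = edge (η k) := by
      intro k
      induction k using Fin.induction with
      | zero =>
        funext z
        rw [h0, edge_bot, Fin.val_zero, partialEdge_zero]
      | succ k ih =>
        rw [he k, ← ih, Fin.val_succ, partialEdge_succ, ← hp k]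
        rfl
    refine ⟨ε, hε, fun k hk => ?_, ?_⟩
    · rw [key ⟨k, Nat.lt_succ_of_le hk⟩]
      exact stepDown_edge _
    · rw [← hl, ← key (Fin.last l), Fin.val_last]
  · rintro ⟨ε, hε, hstep, hl⟩
    have hex : ∀ k : Fin (l + 1), ∃ ν, edge ν = partialEdge s ε k := by
      intro k
      induction k using Fin.induction with
      | zero => exact ⟨⊥, by funext z; rw [edge_bot, Fin.val_zero, partialEdge_zero]⟩
      | succ k ih =>
        -- Contents beyond `n` never occur, which gives the limiting behaviour that `exists_edge_eq`
        -- requires.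
        obtain ⟨n, hn⟩ : ∃ n : ℤ, ∀ m, |(s m).2 - (s m).1| < n := by
          obtain ⟨n, hn⟩ := Finset.exists_le (Finset.univ.image fun m => |(s m).2 - (s m).1|)
          exact ⟨n + 1, fun m => Int.lt_add_one_of_le
            (hn _ (Finset.mem_image_of_mem _ (Finset.mem_univ m)))⟩
        have hfar : ∀ (k : ℕ) z, n ≤ |z| → partialEdge s ε k z = max 0 (-z) := by
          intro k z hz
          unfold partialEdge
          rw [Finset.sum_eq_zero, add_zero]
          intro m _
          rw [if_neg]
          rintro ⟨-, rfl⟩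
          exact absurd (hn m) (not_lt.2 hz)
        exact exists_edge_eq (hstep _ (by simp only [Fin.val_succ]; omega)) (n := n)
          (fun z hz => hfar _ z (by rw [le_abs]; omega))
          (fun z hz => hfar _ z (by rw [le_abs]; omega))
    choose η hη using hex
    have hd : ∀ k : Fin l, DifferBySquare (η k.castSucc) (η k.succ) ∧
        diagDiff (η k.castSucc) (η k.succ) = (s k).2 - (s k).1 := fun k =>
      differBySquare_of_edge_eq (hε k) (by
        rw [hη, hη, Fin.val_succ, Fin.val_castSucc, partialEdge_succ])
    refine ⟨η, ⟨edge_injective ?_, edge_injective ?_, fun k => (hd k).1⟩, fun k => (hd k).2⟩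
    · rw [hη]
      funext z
      rw [edge_bot, Fin.val_zero, partialEdge_zero]
    · rw [hη, Fin.val_last, hl]

/-- A canonical ordering of a subset of the rectangle is the sequence of steps of an oscillating
tableau if and only if the subset is the set of vacancies and osculations of a corner sum
function. -/
theorem exists_isCornerSum_iff (hs : Function.Injective s)
    (hcan : ∀ k k', k < k' → (s k).1 < (s k').1 ∨ (s k).2 < (s k').2)
    (hrect : ∀ m, s m ∈ rect a b) :
    (∃ N, IsCornerSum p N ∧ cornerVacOsc a b N = Finset.univ.image s) ↔
      ∃ η ∈ OT p.partition l, ∀ k, profile η k = (s k).2 - (s k).1 := by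
  rw [exists_mem_OT_iff]
  have hpos : ∀ m, 1 ≤ (s m).1 ∧ 1 ≤ (s m).2 := fun m => by
    have := mem_rect.1 (hrect m)
    omega
  constructor
  · rintro ⟨N, hN, hS⟩
    have hmem : ∀ x y : ℤ, (x, y) ∈ rect a b →
        (N x y ≠ N (x - 1) (y - 1) + 1 ↔ ∃ m, s m = (x, y)) := by
      intro x y hxy
      have := Finset.ext_iff.1 hS (x, y)
      simpa [cornerVacOsc, hxy] using this
    have hdiff : ∀ x y : ℤ, (x, y) ∈ rect a b →
        N (x - 1) (y - 1) ≤ N x y ∧ N x y ≤ N (x - 1) (y - 1) + 2 := by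
      intro x y hxy
      rw [mem_rect] at hxy
      have h1 := hN.row_step x y hxy.1.1 hxy.1.2 (by dsimp at hxy; omega) hxy.2.2
      have h2 := hN.col_step (x - 1) y (by dsimp at hxy; omega) (by dsimp at hxy; omega)
        hxy.2.1 hxy.2.2
      omega
    -- One minus the number of paths through `s m`: `+1` at a vacancy, `-1` at an osculation.
    let ε : Fin l → ℤ := fun m => 1 - N (s m).1 (s m).2 + N ((s m).1 - 1) ((s m).2 - 1)
    have hcorner : ∀ n : ℕ, ∀ y : ℤ, (n : ℤ) ≤ a → 0 ≤ y → y ≤ b →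
        N n y = n - cornerEdge s ε n y := by
      intro n
      induction n with
      | zero =>
        intro y _ h0 h1
        rw [cornerEdge_of_nonpos s ε hpos (by simp), Nat.cast_zero, hN.top y h0 h1]
        omega
      | succ n ih =>
        intro y hn h0 h1
        rcases h0.eq_or_lt with rfl | h0
        · rw [cornerEdge_of_nonpos s ε hpos (by simp), hN.left _ (by omega) hn]
          omega
        · have h2 := ih (y - 1) (by omega) (by omega) (by omega)
          have hr : (((n + 1 : ℕ) : ℤ), y) ∈ rect a b := by
            rw [mem_rect]
            dsimp only
            omega
          have h3 : ((n + 1 : ℕ) : ℤ) - 1 = n := by omega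
          by_cases hm : ∃ m, s m = (((n + 1 : ℕ) : ℤ), y)
          · obtain ⟨m, hm⟩ := hm
            have h4 := cornerEdge_apply s ε hs m
            have h5 : ε m = 1 - N (s m).1 (s m).2 + N ((s m).1 - 1) ((s m).2 - 1) := rfl
            simp only [hm, h3] at h4 h5
            omega
          · have h4 := (hmem _ _ hr).not.2 hm
            rw [cornerEdge_sub_one_eq s ε (by simpa using hm), h3]
            rw [h3] at h4
            omega
    have hcorner' : ∀ x y : ℤ, 0 ≤ x → x ≤ a → 0 ≤ y → y ≤ b →
        cornerEdge s ε x y = x - N x y := by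
      intro x y hx hx' hy hy'
      obtain ⟨n, rfl⟩ := Int.eq_ofNat_of_zero_le hx
      rw [hcorner n y hx' hy hy']
      ring
    refine ⟨ε, fun k => ?_, fun k hk => ?_, ?_⟩
    · have h1 := (hmem (s k).1 (s k).2 (hrect k)).2 ⟨k, rfl⟩
      have h2 := hdiff (s k).1 (s k).2 (hrect k)
      simp only [ε]
      omega
    -- A step changes one value only, so `StepDown` needs checking only at the content of that step
    -- and at the content before it. There it is the row and column condition of `N` at the corner
    -- `s k`.
    · induction k with
      | zero =>
        rw [show partialEdge s ε 0 = fun z => max 0 (-z) from funext (partialEdge_zero s ε)]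
        exact stepDown_max_neg
      | succ k ih =>
        have ih := ih (by omega)
        have hsucc := partialEdge_succ s ε ⟨k, hk⟩
        have hcut := (isCut_succ hcan ⟨k, hk⟩).partialEdge_eq ε
        have hr := mem_rect.1 (hrect ⟨k, hk⟩)
        dsimp only at hsucc hcut
        generalize (s ⟨k, hk⟩).1 = x at *
        generalize (s ⟨k, hk⟩).2 = y at *
        rw [hcorner' x y (by omega) (by omega) (by omega) (by omega),
          hcorner' (x - 1) y (by omega) (by omega) (by omega) (by omega),
          hcorner' x (y - 1) (by omega) (by omega) (by omega) (by omega)] at hcut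
        have h1 := hN.row_step x y (by omega) (by omega) (by omega) (by omega)
        have h2 := hN.col_step x y (by omega) (by omega) (by omega) (by omega)
        intro z
        by_cases hz : z = y - x
        · rw [hz]
          omega
        · by_cases hz' : z + 1 = y - x
          · rw [hz', show z = y - x - 1 by omega]
            omega
          · have := ih z
            rw [hsucc]
            simpa [hz, hz'] using this
    · obtain ⟨h1, h2, h3⟩ := partialEdge_last_eq ε hrect
      funext z
      by_cases hz : z < -a ∨ b < z
      · rw [h3 z hz, p.edge_partition_of_lt hz]
      · rcases le_total z (b - a) with h | h
        · obtain ⟨y, rfl⟩ : ∃ y : ℤ, z = y - a := ⟨z + a, by ring⟩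
          rw [h1, p.edge_partition_bottom (by omega) (by omega),
            hcorner' _ _ (by omega) (by omega) (by omega) (by omega),
            hN.bottom y (by omega) (by omega)]
        · obtain ⟨x, rfl⟩ : ∃ x : ℤ, z = b - x := ⟨b - z, by ring⟩
          rw [h2, p.edge_partition_right (by omega) (by omega),
            hcorner' _ _ (by omega) (by omega) (by omega) (by omega),
            hN.right x (by omega) (by omega)]
  · rintro ⟨ε, hε, hstep, hl⟩
    -- The sequence is constant from `l` on, so the index of a cut need not be bounded.
    have hstep' : ∀ k, StepDown (partialEdge s ε k) := by
      intro k
      rcases le_total k l with h | h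
      · exact hstep k h
      · have : partialEdge s ε k = partialEdge s ε l := by
          funext z
          unfold partialEdge
          congr 1
          refine Finset.sum_congr rfl fun m _ => if_congr ?_ rfl rfl
          have := m.2
          simp only [this, this.trans_le h]
        rw [this]
        exact hstep l le_rfl
    obtain ⟨h1, h2, h3⟩ := partialEdge_last_eq ε hrect
    refine ⟨fun x y => x - cornerEdge s ε x y, ⟨?_, ?_, ?_, ?_, ?_, ?_⟩, ?_⟩
    · intro y hy _
      rw [cornerEdge_of_nonpos s ε hpos (by simp)]
      omega
    · intro x hx _
      rw [cornerEdge_of_nonpos s ε hpos (by simp)]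
      omega
    · intro x y _ _ _ _
      -- At the moment cut off by `(x, y)`, `StepDown` at content `y - x` is the row condition. For
      -- the column condition below, the content is `y - x - 1`.
      obtain ⟨k, hk⟩ := exists_isCut hcan (x, y)
      have h4 := hk.partialEdge_eq ε
      have h5 := hstep' k (y - x)
      omega
    · intro x y _ _ _ _
      obtain ⟨k, hk⟩ := exists_isCut hcan (x, y)
      have h4 := hk.partialEdge_eq ε
      have h5 := hstep' k (y - x - 1)
      rw [sub_add_cancel] at h5
      omega
    · intro y hy hy'
      rw [← h1, hl, p.edge_partition_bottom hy hy']
      ring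
    · intro x hx hx'
      rw [← h2, hl, p.edge_partition_right hx hx']
      ring
    · ext ⟨x, y⟩
      simp only [cornerVacOsc, Finset.mem_filter, Finset.mem_image, Finset.mem_univ, true_and]
      constructor
      · rintro ⟨-, h⟩
        by_contra hm
        apply h
        rw [cornerEdge_sub_one_eq s ε (by simpa using hm)]
        ring
      · rintro ⟨m, hm⟩
        have h4 := cornerEdge_apply s ε hs m
        have h5 := hrect m
        rw [hm] at h4 h5
        have h6 := hε m
        dsimp only at h4
        exact ⟨h5, by omega⟩

end Heights

/-! ## Paths as functions of the content -/

/-- `f z` is the row of the point with content `z` on a path from `(a, β)` to `(α, b)`. -/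
structure IsPathFn (a b α β : ℕ) (f : ℤ → ℤ) : Prop where
  start : f (β - a) = a
  finish : f (b - α) = α
  step : ∀ z : ℤ, β - a ≤ z → z < b - α → f (z + 1) ≤ f z ∧ f z ≤ f (z + 1) + 1

/-- The `m`-th point of `w` has content `β - a + m`, and its row is given by `f`. -/
def Follows (a b α β : ℕ) (f : ℤ → ℤ) (w : List (ℤ × ℤ)) : Prop :=
  ∀ (m : ℕ) (i j : ℤ), w[m]? = some (i, j) ↔ j - i = β - a + m ∧ j - i ≤ b - α ∧ f (j - i) = i

/-- The osculation condition in terms of path functions with domains `[s, t]` and `[s', t']`. -/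
def OscFn (s t s' t' : ℤ) (f f' : ℤ → ℤ) : Prop :=
  ∀ z, s ≤ z → z ≤ t → s' ≤ z → z ≤ t' → f z = f' z →
    (s < z ∧ f (z - 1) = f z) ∧ (z < t ∧ f (z + 1) = f z - 1) ∧
    (s' < z → f' (z - 1) = f' z + 1) ∧ (z < t' → f' (z + 1) = f' z)

section Path

variable {a b α β : ℕ} {f : ℤ → ℤ} {w : List (ℤ × ℤ)}

lemma IsPathFn.le_start (hf : IsPathFn a b α β f) {z : ℤ} (h : β - a ≤ z) (h' : z ≤ b - α) :
    f z ≤ a ∧ β ≤ f z + z := by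
  induction z, h using Int.leInduction with
  | base =>
    rw [hf.start]
    omega
  | succ z hz ih =>
    have := hf.step z hz (by omega)
    have := ih (by omega)
    omega

lemma IsPathFn.finish_le (hf : IsPathFn a b α β f) {z : ℤ} (h : β - a ≤ z) (h' : z ≤ b - α) :
    α ≤ f z ∧ f z + z ≤ b := by
  induction z, h' using Int.leInductionDown with
  | base =>
    rw [hf.finish]
    omega
  | pred z hz ih =>
    have := hf.step (z - 1) h (by omega)
    rw [sub_add_cancel] at this
    have := ih (by omega)
    omega

lemma IsPath.exists_follows (hw : IsPath a b α β w) :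
    ∃ f, IsPathFn a b α β f ∧ Follows a b α β f w := by
  have hstart : w[0]? = some ((a : ℤ), (β : ℤ)) := by rw [← hw.start, List.head?_eq_getElem?]
  have hfin := hw.finish
  rw [List.getLast?_eq_getElem?] at hfin
  have hlen : 0 < w.length := (List.getElem?_eq_some_iff.1 hstart).1
  have hstep : ∀ (m : ℕ) (x y : ℤ × ℤ), w[m]? = some x → w[m + 1]? = some y → IsStep x y := by
    intro m x y hx hy
    obtain ⟨h1, rfl⟩ := List.getElem?_eq_some_iff.1 hx
    obtain ⟨h2, rfl⟩ := List.getElem?_eq_some_iff.1 hy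
    exact List.isChain_iff_getElem.1 hw.steps m h2
  have hstep' : ∀ (m : ℕ) (x y : ℤ × ℤ), w[m]? = some x → w[m + 1]? = some y →
      y.2 - y.1 = x.2 - x.1 + 1 ∧ y.1 ≤ x.1 ∧ x.1 ≤ y.1 + 1 := by
    intro m x y hx hy
    have := hstep m x y hx hy
    simp only [IsStep, Prod.ext_iff, Prod.fst_sub, Prod.snd_sub] at this
    omega
  have hcont : ∀ (m : ℕ) (x : ℤ × ℤ), w[m]? = some x → x.2 - x.1 = β - a + m := by
    intro m
    induction m with
    | zero =>
      intro x hx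
      obtain rfl := Option.some.inj (hstart.symm.trans hx)
      simp
    | succ m ih =>
      intro x hx
      have hm : m < w.length := by
        have := (List.getElem?_eq_some_iff.1 hx).1
        omega
      have h1 := ih _ (List.getElem?_eq_getElem hm)
      have h2 := (hstep' m _ x (List.getElem?_eq_getElem hm) hx).1
      push_cast
      omega
  have hlast := hcont _ _ hfin
  dsimp only at hlast
  obtain ⟨f, hf⟩ : ∃ f : ℤ → ℤ, ∀ (m : ℕ) (x : ℤ × ℤ), w[m]? = some x →
      f (β - a + m) = x.1 := by
    -- The content grows by one per step, so it gives the position in the list. The default is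
    -- reached only past the end of the path, where `f` is unconstrained.
    refine ⟨fun z => (w[(z - (β - a)).toNat]?.getD (0, 0)).1, fun m x hx => ?_⟩
    dsimp only
    rw [show ((β : ℤ) - a + m - (β - a)).toNat = m by omega, hx]
    rfl
  refine ⟨f, ⟨?_, ?_, ?_⟩, ?_⟩
  · simpa using hf 0 _ hstart
  · rw [hlast]
    exact hf _ _ hfin
  · intro z h1 h2
    obtain ⟨m, rfl⟩ : ∃ m : ℕ, z = β - a + m := ⟨(z - (β - a)).toNat, by omega⟩
    have hm : m + 1 < w.length := by omega
    have h3 := List.getElem?_eq_getElem hm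
    have h4 := List.getElem?_eq_getElem (show m < w.length by omega)
    have h5 := hf _ _ h3
    push_cast at h5
    rw [← add_assoc] at h5
    rw [h5, hf _ _ h4]
    exact (hstep' m _ _ h4 h3).2
  · intro m i j
    constructor
    · intro h
      have h1 := hcont _ _ h
      dsimp only at h1
      have h2 := (List.getElem?_eq_some_iff.1 h).1
      refine ⟨h1, by omega, ?_⟩
      rw [h1]
      exact hf _ _ h
    · rintro ⟨h1, h2, h3⟩
      have hm : m < w.length := by omega
      have h4 := List.getElem?_eq_getElem hm
      have h5 := hcont _ _ h4
      rw [h1, hf _ _ h4] at h3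
      rw [h4, Option.some.injEq, Prod.ext_iff]
      exact ⟨h3, by dsimp only; omega⟩

lemma IsPathFn.exists_isPath (hf : IsPathFn a b α β f) (hα : α ≤ a) (hβ : β ≤ b) :
    ∃ w, IsPath a b α β w ∧ Follows a b α β f w := by
  let g : ℕ → ℤ × ℤ := fun m => (f (β - a + m), f (β - a + m) + (β - a + m))
  have hw : ∀ m, ((List.range (a - α + (b - β) + 1)).map g)[m]? =
      if m < a - α + (b - β) + 1 then some (g m) else none := by
    intro m
    rw [List.getElem?_map]
    split_ifs with h
    · rw [List.getElem?_range h]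
      rfl
    · rw [List.getElem?_eq_none (by simpa using h)]
      rfl
  refine ⟨(List.range (a - α + (b - β) + 1)).map g, ⟨?_, ?_, ?_⟩, ?_⟩
  · rw [List.head?_eq_getElem?, hw, if_pos (Nat.succ_pos _)]
    simp [g, hf.start]
  · rw [List.getLast?_eq_getElem?, hw, List.length_map, List.length_range, Nat.add_sub_cancel,
      if_pos (Nat.lt_succ_self _)]
    simp only [g]
    rw [show (β : ℤ) - a + ((a - α + (b - β) : ℕ) : ℤ) = b - α by omega, hf.finish]
    simp
  · rw [List.isChain_iff_getElem]
    intro m hm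
    simp only [List.length_map, List.length_range] at hm
    simp only [List.getElem_map, List.getElem_range, g, IsStep, Prod.ext_iff, Prod.fst_sub,
      Prod.snd_sub]
    have := hf.step (β - a + m) (by omega) (by omega)
    push_cast
    rw [← add_assoc]
    omega
  · intro m i j
    rw [hw]
    split_ifs with h
    · simp only [g, Option.some.injEq, Prod.ext_iff]
      constructor
      · rintro ⟨h1, h2⟩
        have h3 : j - i = β - a + m := by omega
        rw [h3]
        exact ⟨rfl, by omega, h1⟩
      · rintro ⟨h1, h2, h3⟩
        rw [h1] at h3
        omega
    · simp only [false_iff]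
      omega

lemma Follows.mem_iff (h : Follows a b α β f w) (x y : ℤ) :
    (x, y) ∈ w ↔ (β : ℤ) - a ≤ y - x ∧ y - x ≤ b - α ∧ f (y - x) = x := by
  rw [List.mem_iff_getElem?]
  constructor
  · rintro ⟨m, hm⟩
    have := (h m x y).1 hm
    omega
  · rintro ⟨h1, h2, h3⟩
    exact ⟨(y - x - (β - a)).toNat, (h _ x y).2 ⟨by omega, h2, h3⟩⟩

/-- The left and lower neighbours of a point have content one less, the upper and right neighbours
one more. The row then tells apart the two possible predecessors or successors. -/
lemma Follows.osculating_iff {α' β' : ℕ} {f' : ℤ → ℤ} {w' : List (ℤ × ℤ)}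
    (h : Follows a b α β f w) (h' : Follows a b α' β' f' w') :
    Osculating w w' ↔ OscFn (β - a) (b - α) (β' - a) (b - α') f f' := by
  have hlen : ∀ (m' : ℕ) (i j : ℤ), w'[m']? = some (i, j) →
      (m' + 1 ≠ w'.length ↔ j - i < b - α') := by
    intro m' i j hm
    have h1 := (List.getElem?_eq_some_iff.1 hm).1
    have h2 := (h' _ _ _).1 hm
    constructor
    · intro hne
      have h3 := List.getElem?_eq_getElem (show m' + 1 < w'.length by omega)
      have h4 := (h' (m' + 1) _ _).1 h3
      omega
    · intro hlt
      have h3 := (h' (m' + 1) (f' (j - i + 1)) (f' (j - i + 1) + (j - i + 1))).2 (by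
        rw [add_sub_cancel_left]
        push_cast
        omega)
      have h4 := (List.getElem?_eq_some_iff.1 h3).1
      omega
  constructor
  · intro ho z hz1 hz2 hz1' hz2' heq
    have e1 := (h (z - (β - a)).toNat (f z) (f z + z)).2 (by
      rw [add_sub_cancel_left]
      omega)
    have e2 := (h' (z - (β' - a)).toNat (f z) (f z + z)).2 (by
      rw [add_sub_cancel_left]
      omega)
    obtain ⟨⟨o1, o2⟩, o3, o4, o5⟩ := ho _ _ _ _ e1 e2
    have o6 := hlen _ _ _ e2
    rw [h] at o2 o3
    rw [h'] at o4 o5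
    rw [show f z + z - 1 - f z = z - 1 by ring] at o2
    rw [show f z + z - (f z - 1) = z + 1 by ring] at o3
    rw [show f z + z - (f z + 1) = z - 1 by ring] at o4
    rw [show f z + z + 1 - f z = z + 1 by ring] at o5
    rw [add_sub_cancel_left] at o6
    refine ⟨⟨by omega, o2.2.2⟩, ⟨by omega, o3.2.2⟩, fun hlt => ?_, fun hlt => ?_⟩
    · rw [(o4 (by omega)).2.2, heq]
    · rw [(o5 (o6.2 hlt)).2.2, heq]
  · intro ho m m' i j hm hm'
    have o6 := hlen _ _ _ hm'
    rw [o6]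
    rw [h] at hm
    rw [h'] at hm'
    have := ho (j - i) (by omega) (by omega) (by omega) (by omega) (by omega)
    rw [h, h, h', h', show j - 1 - i = j - i - 1 by ring, show j - (i - 1) = j - i + 1 by ring,
      show j - (i + 1) = j - i - 1 by ring, show j + 1 - i = j - i + 1 by ring]
    omega

end Path

/-- Tuples of osculating paths in terms of path functions. -/
structure IsOscFamily {a b : ℕ} (p : BoundaryPair a b) (F : Fin p.r → ℤ → ℤ) : Prop where
  isPathFn : ∀ k, IsPathFn a b (p.alpha k) (p.beta k) (F k)
  osc : ∀ k k' : Fin p.r, (k' : ℕ) = k + 1 →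
    OscFn (p.beta k - a) (b - p.alpha k) (p.beta k' - a) (b - p.alpha k') (F k) (F k')

/-- The path given by `F k` passes through `(x, y)`. -/
def OnPath {a b : ℕ} (p : BoundaryPair a b) (F : Fin p.r → ℤ → ℤ) (k : Fin p.r) (x y : ℤ) : Prop :=
  (p.beta k : ℤ) - a ≤ y - x ∧ y - x ≤ b - p.alpha k ∧ F k (y - x) = x

/-! ### Osculating path families and corner sums -/

section Family

variable {a b : ℕ} {p : BoundaryPair a b}

lemma exists_isOscFamily {P : Fin p.r → List (ℤ × ℤ)} (hP : P ∈ OP a b p) :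
    ∃ F, IsOscFamily p F ∧ ∀ k x y, (x, y) ∈ P k ↔ OnPath p F k x y := by
  choose F hF hFP using fun k => (hP.1 k).exists_follows
  exact ⟨F, ⟨hF, fun k k' h => ((hFP k).osculating_iff (hFP k')).1 (hP.2 k k' h)⟩,
    fun k => (hFP k).mem_iff⟩

lemma IsOscFamily.exists_mem_OP {F : Fin p.r → ℤ → ℤ} (hF : IsOscFamily p F) :
    ∃ P ∈ OP a b p, ∀ k x y, (x, y) ∈ P k ↔ OnPath p F k x y := by
  choose P hP hFP using fun k =>
    (hF.isPathFn k).exists_isPath (p.alpha_mem k).2 (p.beta_mem k).2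
  exact ⟨P, ⟨hP, fun k k' h => ((hFP k).osculating_iff (hFP k')).2 (hF.osc k k' h)⟩,
    fun k => (hFP k).mem_iff⟩

lemma alpha_lt {k k' : Fin p.r} (h : k < k') : p.alpha k < p.alpha k' := p.alpha.strictMono h

lemma beta_lt {k k' : Fin p.r} (h : k < k') : p.beta k < p.beta k' := p.beta.strictMono h

/-- Successive paths are weakly ordered from the upper left to the lower right. -/
lemma IsOscFamily.le_of_succ {F : Fin p.r → ℤ → ℤ} (hF : IsOscFamily p F) {k k' : Fin p.r}
    (hk : (k' : ℕ) = k + 1) {z : ℤ} (h : p.beta k' - a ≤ z) (h' : z ≤ b - p.alpha k') :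
    F k z ≤ F k' z := by
  have hlt : k < k' := by
    rw [Fin.lt_def]
    omega
  have h1 := alpha_lt hlt
  have h2 := beta_lt hlt
  induction z, h using Int.leInduction with
  | base =>
    rw [(hF.isPathFn k').start]
    exact ((hF.isPathFn k).le_start (by omega) (by omega)).1
  | succ z hz ih =>
    have h3 := ih (by omega)
    have h4 := (hF.isPathFn k).step z (by omega) (by omega)
    have h5 := (hF.isPathFn k').step z (by omega) (by omega)
    -- If the paths meet at `z`, osculation makes `F k` drop and `F k'` stay. Otherwise there is a
    -- gap of at least one, which a single step cannot reverse.
    have h6 := hF.osc k k' hk z (by omega) (by omega) (by omega) (by omega)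
    omega

/-- Any two paths are osculating. -/
lemma IsOscFamily.oscFn {F : Fin p.r → ℤ → ℤ} (hF : IsOscFamily p F) {k k' : Fin p.r}
    (hk : k < k') :
    OscFn (p.beta k - a) (b - p.alpha k) (p.beta k' - a) (b - p.alpha k') (F k) (F k') := by
  suffices H : ∀ (n : ℕ) (k k' : Fin p.r), (k' : ℕ) = k + n + 1 →
      (∀ z : ℤ, p.beta k' - a ≤ z → z ≤ b - p.alpha k' → F k z ≤ F k' z) ∧
      OscFn (p.beta k - a) (b - p.alpha k) (p.beta k' - a) (b - p.alpha k') (F k) (F k') from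
    (H (k' - k - 1) k k' (by rw [Fin.lt_def] at hk; omega)).2
  intro n
  induction n with
  | zero => exact fun k k' h => ⟨fun z => hF.le_of_succ h, hF.osc k k' h⟩
  | succ n ih =>
    intro k k' h
    obtain ⟨m, hm⟩ : ∃ m : Fin p.r, (m : ℕ) = k + n + 1 := ⟨⟨k + n + 1, by omega⟩, rfl⟩
    have hmk : m < k' := by
      rw [Fin.lt_def]
      omega
    have h1 := alpha_lt hmk
    have h2 := beta_lt hmk
    obtain ⟨h3, h4⟩ := ih k m hm
    have h5 : ∀ z : ℤ, p.beta k' - a ≤ z → z ≤ b - p.alpha k' → F m z ≤ F k' z :=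
      fun z => hF.le_of_succ (by omega)
    refine ⟨fun z hz hz' => (h3 z (by omega) (by omega)).trans (h5 z hz hz'), ?_⟩
    intro z hz1 hz2 hz3 hz4 heq
    have h6 := h3 z (by omega) (by omega)
    have h7 := h5 z hz3 hz4
    have h8 := h4 z hz1 hz2 (by omega) (by omega) (by omega)
    have h9 := hF.osc m k' (by omega) z (by omega) (by omega) hz3 hz4 (by omega)
    -- The intermediate path `m` is squeezed through the same point. It would have to leave to the
    -- right because of `k` and upwards because of `k'`, so non-consecutive paths never meet.
    omega

lemma card_filter_eq_add {ι : Type*} [Fintype ι] (P Q : ι → Prop) [DecidablePred P]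
    [DecidablePred Q] (h : ∀ k, P k → Q k) :
    (Finset.univ.filter Q).card =
      (Finset.univ.filter P).card + (Finset.univ.filter fun k => Q k ∧ ¬P k).card := by
  classical
  rw [← Finset.card_union_of_disjoint]
  · congr 1
    ext k
    have := h k
    simp only [Finset.mem_filter, Finset.mem_univ, true_and, Finset.mem_union]
    tauto
  · rw [Finset.disjoint_filter]
    tauto

-- `R k x y` says that path `k` meets the diagonal of `(x, y)` weakly above and to the left of `(x,
-- y)`, and `N` counts such paths. Two paths gained in one unit step would share the point `(x, y)`
-- in a way that osculation excludes.
open Classical in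
lemma IsOscFamily.exists_isCornerSum {F : Fin p.r → ℤ → ℤ} (hF : IsOscFamily p F) :
    ∃ N, IsCornerSum p N ∧ ∀ x y, (x, y) ∈ rect a b →
      N x y = N (x - 1) (y - 1) + ((Finset.univ.filter fun k => OnPath p F k x y).card : ℤ) := by
  let R : Fin p.r → ℤ → ℤ → Prop := fun k x y =>
    (p.beta k : ℤ) - a ≤ y - x ∧ y - x ≤ b - p.alpha k ∧ F k (y - x) ≤ x
  let N : ℤ → ℤ → ℤ := fun x y => ((Finset.univ.filter fun k => R k x y).card : ℤ)
  have hbd : ∀ k (z : ℤ), (p.beta k : ℤ) - a ≤ z → z ≤ b - p.alpha k →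
      (F k z ≤ a ∧ p.beta k ≤ F k z + z) ∧ p.alpha k ≤ F k z ∧ F k z + z ≤ b :=
    fun k z h1 h2 => ⟨(hF.isPathFn k).le_start h1 h2, (hF.isPathFn k).finish_le h1 h2⟩
  have hzero : ∀ x y : ℤ, x = 0 ∨ y = 0 → N x y = 0 := by
    intro x y h
    simp only [N, Nat.cast_eq_zero, Finset.card_eq_zero, Finset.filter_eq_empty_iff]
    rintro k - ⟨h1, h2, h3⟩
    have h4 := hbd k _ h1 h2
    have h5 := p.alpha_mem k
    have h6 := p.beta_mem k
    omega
  have hstep : ∀ x y x' y' : ℤ, (∀ k, R k x' y' → R k x y) →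
      (∀ k k', k < k' → R k x y → ¬R k x' y' → R k' x y → ¬R k' x' y' → False) →
      N x' y' ≤ N x y ∧ N x y ≤ N x' y' + 1 := by
    intro x y x' y' h1 h2
    simp only [N]
    rw [card_filter_eq_add _ _ h1]
    have : (Finset.univ.filter fun k => R k x y ∧ ¬R k x' y').card ≤ 1 := by
      rw [Finset.card_le_one]
      intro k hk k' hk'
      simp only [Finset.mem_filter, Finset.mem_univ, true_and] at hk hk'
      rcases lt_trichotomy k k' with h | h | h
      · exact (h2 k k' h hk.1 hk.2 hk'.1 hk'.2).elim
      · exact h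
      · exact (h2 k' k h hk'.1 hk'.2 hk.1 hk.2).elim
    omega
  refine ⟨N, ⟨fun y _ _ => hzero _ _ (Or.inl rfl), fun x _ _ => hzero _ _ (Or.inr rfl),
    fun x y hx hx' hy hy' => ?_, fun x y hx hx' hy hy' => ?_, fun y hy hy' => ?_,
    fun x hx hx' => ?_⟩, fun x y hxy => ?_⟩
  -- A path gained in this step passes through `(x, y)` and does not leave upwards. Of two paths
  -- meeting at a point, the upper left one must leave upwards.
  · have hlast : ∀ k, R k x y → ¬R k (x - 1) y → F k (y - x) = x ∧
        (y - x = b - p.alpha k ∨ F k (y - x + 1) = x) := by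
      rintro k ⟨h1, h2, h3⟩ h4
      simp only [R, show y - (x - 1) = y - x + 1 by ring] at h4
      have h5 := hbd k _ h1 h2
      have h6 := (hF.isPathFn k).step (y - x) h1
      omega
    refine hstep x y (x - 1) y (fun k => ?_) fun k k' hk h1 h2 h3 h4 => ?_
    · simp only [R, show y - (x - 1) = y - x + 1 by ring]
      rintro ⟨h1, h2, h3⟩
      have h4 := (hF.isPathFn k).start
      rcases h1.eq_or_lt with h5 | h5
      · rw [← h5] at h3
        omega
      · have h6 := (hF.isPathFn k).step (y - x) (by omega) (by omega)
        omega
    · have h5 := hlast k h1 h2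
      have h6 := hlast k' h3 h4
      have h7 := hF.oscFn hk (y - x) h1.1 h1.2.1 h3.1 h3.2.1 (by omega)
      omega
  -- A path gained in this step passes through `(x, y)` and does not come from the left, as the
  -- upper left one of two meeting paths must.
  · have hlast : ∀ k, R k x y → ¬R k x (y - 1) → F k (y - x) = x ∧
        (y - x = p.beta k - a ∨ F k (y - x - 1) = x + 1) := by
      rintro k ⟨h1, h2, h3⟩ h4
      simp only [R, show y - 1 - x = y - x - 1 by ring] at h4
      have h5 := hbd k _ h1 h2
      have h6 := (hF.isPathFn k).step (y - x - 1)
      rw [sub_add_cancel] at h6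
      rcases h1.eq_or_lt with h7 | h7
      · have h8 := (hF.isPathFn k).start
        rw [h7] at h8
        omega
      · have := h6 (by omega) (by omega)
        omega
    refine hstep x y x (y - 1) (fun k => ?_) fun k k' hk h1 h2 h3 h4 => ?_
    · simp only [R, show y - 1 - x = y - x - 1 by ring]
      rintro ⟨h1, h2, h3⟩
      have h4 := (hF.isPathFn k).finish
      rcases h2.eq_or_lt with h5 | h5
      · rw [h5] at h3
        omega
      · have h6 := (hF.isPathFn k).step (y - x - 1) (by omega) (by omega)
        rw [sub_add_cancel] at h6
        omega
    · have h5 := hlast k h1 h2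
      have h6 := hlast k' h3 h4
      have h7 := hF.oscFn hk (y - x) h1.1 h1.2.1 h3.1 h3.2.1 (by omega)
      omega
  · rw [countLE_eq_card p.cols p.card_eq.symm]
    simp only [N]
    congr 2
    ext k
    simp only [Finset.mem_filter, Finset.mem_univ, true_and]
    change R k a y ↔ (p.beta k : ℤ) ≤ y
    have h1 := p.alpha_mem k
    have h2 := hbd k (y - a)
    simp only [R]
    omega
  · rw [countLE_eq_card p.rows rfl]
    simp only [N]
    congr 2
    ext k
    simp only [Finset.mem_filter, Finset.mem_univ, true_and]
    change R k x b ↔ (p.alpha k : ℤ) ≤ x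
    have h1 := p.beta_mem k
    have h2 := hbd k (b - x)
    simp only [R]
    omega
  · simp only [N]
    rw [card_filter_eq_add (fun k => R k (x - 1) (y - 1)) (fun k => R k x y), Nat.cast_add]
    · congr 3
      ext k
      simp only [Finset.mem_filter, Finset.mem_univ, true_and]
      simp only [R, OnPath, sub_sub_sub_cancel_right]
      constructor
      · rintro ⟨⟨h1, h2, h3⟩, h4⟩
        exact ⟨h1, h2, by omega⟩
      · rintro ⟨h1, h2, h3⟩
        exact ⟨⟨h1, h2, h3.le⟩, fun h => by omega⟩
    · intro k
      simp only [R, sub_sub_sub_cancel_right]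
      omega

lemma card_filter_Ico {r : ℕ} {m n : ℤ} (hm : 0 ≤ m) (hmn : m ≤ n) (hn : n ≤ r) :
    ((Finset.univ.filter fun k : Fin r => m ≤ (k : ℤ) ∧ (k : ℤ) < n).card : ℤ) = n - m := by
  obtain ⟨m, rfl⟩ := Int.eq_ofNat_of_zero_le hm
  obtain ⟨n, rfl⟩ := Int.eq_ofNat_of_zero_le (hm.trans hmn)
  rw [← Finset.card_map Fin.valEmbedding]
  have : (Finset.univ.filter fun k : Fin r => (m : ℤ) ≤ (k : ℤ) ∧ (k : ℤ) < n).map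
      Fin.valEmbedding = Finset.Ico m n := by
    ext k
    simp only [Finset.mem_map, Finset.mem_filter, Finset.mem_univ, true_and, Fin.valEmbedding_apply,
      Finset.mem_Ico]
    constructor
    · rintro ⟨k, h, rfl⟩
      omega
    · intro h
      exact ⟨⟨k, by omega⟩, by dsimp only; omega, rfl⟩
  rw [this, Nat.card_Ico]
  omega

/-- The boundaries of successive superlevel sets of a corner sum function are osculating paths. -/
lemma IsCornerSum.oscFn {N : ℤ → ℤ → ℤ} (hN : IsCornerSum p N) {k k' : Fin p.r}
    (hk : (k' : ℕ) = k + 1) {f f' : ℤ → ℤ} (hf : IsPathFn a b (p.alpha k) (p.beta k) f)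
    (hf' : IsPathFn a b (p.alpha k') (p.beta k') f')
    (hx : ∀ z : ℤ, p.beta k - a ≤ z → z ≤ b - p.alpha k → ∀ x : ℤ, 0 ≤ x → x ≤ a → 0 ≤ x + z →
      x + z ≤ b → ((k : ℤ) < N x (x + z) ↔ f z ≤ x))
    (hx' : ∀ z : ℤ, p.beta k' - a ≤ z → z ≤ b - p.alpha k' → ∀ x : ℤ, 0 ≤ x → x ≤ a →
      0 ≤ x + z → x + z ≤ b → ((k' : ℤ) < N x (x + z) ↔ f' z ≤ x)) :
    OscFn (p.beta k - a) (b - p.alpha k) (p.beta k' - a) (b - p.alpha k') f f' := by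
  intro z h1 h2 h1' h2' heq
  have hα := p.alpha_mem k
  have hβ := p.beta_mem k
  have hb1 := hf.le_start h1 h2
  have hb2 := hf.finish_le h1 h2
  obtain ⟨x, hxz⟩ : ∃ x, f z = x := ⟨_, rfl⟩
  obtain ⟨y, hyz⟩ : ∃ y, x + z = y := ⟨_, rfl⟩
  rw [hxz, hyz] at hb1 hb2
  rw [hxz] at heq
  obtain ⟨⟨hx2, hy1⟩, hx1, hy2⟩ := And.intro hb1 hb2
  -- The common point gives `N x y ≥ k + 2` and `N (x - 1) (y - 1) ≤ k`. As `N` has unit steps, both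
  -- are equalities, and the two corners in between have value `k + 1`.
  have c1 : N x y = k + 2 ∧ N (x - 1) y = k + 1 ∧ N x (y - 1) = k + 1 := by
    have hA := (hx' z h1' h2' x (by omega) hx2 (by omega) (by omega)).2 heq.ge
    have hB := (hx z h1 h2 (x - 1) (by omega) (by omega) (by omega) (by omega)).not.2 (by omega)
    rw [hyz] at hA
    rw [show x - 1 + z = y - 1 by omega] at hB
    have hr := hN.row_step x y (by omega) (by omega) (by omega) (by omega)
    have hr' := hN.row_step x (y - 1) (by omega) (by omega) (by omega) (by omega)
    have hc := hN.col_step x y (by omega) (by omega) (by omega) (by omega)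
    have hc' := hN.col_step (x - 1) y (by omega) (by omega) (by omega) (by omega)
    omega
  obtain ⟨c1, c2, c3⟩ := c1
  -- If path `k` started here, then `N a (β_k - 1) = k + 1` would give `β_k ≤ β_k - 1`.
  have hlo : (p.beta k : ℤ) - a < z := by
    refine h1.lt_of_ne fun h => ?_
    have hs := hf.start
    rw [h, hxz] at hs
    have hC := p.beta_le_iff k (p.beta k - 1)
    rw [← hN.bottom _ (by omega) (by omega), show (p.beta k : ℤ) - 1 = y - 1 by omega, ← hs,
      c3] at hC
    omega
  have hhi : z < b - p.alpha k := by
    refine h2.lt_of_ne fun h => ?_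
    have hs := hf.finish
    rw [← h, hxz] at hs
    have hC := p.alpha_le_iff k (p.alpha k - 1)
    rw [← hN.right _ (by omega) (by omega), ← hs, show (b : ℤ) = y by omega, c2] at hC
    omega
  rw [hxz, heq]
  refine ⟨⟨hlo, ?_⟩, ⟨hhi, ?_⟩, fun h => ?_, fun h => ?_⟩
  · have e1 := hx (z - 1) (by omega) (by omega) x (by omega) (by omega) (by omega) (by omega)
    rw [show x + (z - 1) = y - 1 by omega, c3] at e1
    have e2 := (hf.step (z - 1) (by omega) (by omega)).1
    rw [sub_add_cancel, hxz] at e2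
    omega
  · have e1 := hx (z + 1) (by omega) (by omega) (x - 1) (by omega) (by omega) (by omega) (by omega)
    rw [show x - 1 + (z + 1) = y by omega, c2] at e1
    have e2 := (hf.step z (by omega) (by omega)).2
    rw [hxz] at e2
    omega
  · have e1 := hx' (z - 1) (by omega) (by omega) x (by omega) (by omega) (by omega) (by omega)
    rw [show x + (z - 1) = y - 1 by omega, c3] at e1
    have e2 := (hf'.step (z - 1) (by omega) (by omega)).2
    rw [sub_add_cancel] at e2
    omega
  · have e1 := hx' (z + 1) (by omega) (by omega) (x - 1) (by omega) (by omega) (by omega)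
      (by omega)
    rw [show x - 1 + (z + 1) = y by omega, c2] at e1
    have e2 := (hf'.step z (by omega) (by omega)).1
    omega

-- Path `k` visits, on each diagonal, the first point at which `N` exceeds `k`. Hence the paths
-- through `(x, y)` are those with `N (x - 1) (y - 1) ≤ k < N x y`.
open Classical in
lemma IsCornerSum.exists_isOscFamily {N : ℤ → ℤ → ℤ} (hN : IsCornerSum p N) :
    ∃ F, IsOscFamily p F ∧ ∀ x y, (x, y) ∈ rect a b →
      N x y = N (x - 1) (y - 1) + ((Finset.univ.filter fun k => OnPath p F k x y).card : ℤ) := by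
  -- Clamping extends `N` to a monotone function on the whole plane, so no range conditions are
  -- needed when searching along diagonals.
  let M : ℤ → ℤ → ℤ := fun x y => N (max 0 (min x a)) (max 0 (min y b))
  have hMN : ∀ x y : ℤ, 0 ≤ x → x ≤ a → 0 ≤ y → y ≤ b → M x y = N x y := by
    intro x y hx hx' hy hy'
    simp only [M]
    rw [min_eq_left hx', min_eq_left hy', max_eq_right hx, max_eq_right hy]
  have hM0 : ∀ x y : ℤ, x ≤ 0 ∨ y ≤ 0 → M x y = 0 := by
    rintro x y (h | h)
    · simp only [M]
      rw [show max 0 (min x (a : ℤ)) = 0 by omega]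
      exact hN.top _ (by omega) (by omega)
    · simp only [M]
      rw [show max 0 (min y (b : ℤ)) = 0 by omega]
      exact hN.left _ (by omega) (by omega)
  have hrow : ∀ x y, M x y ≤ M (x + 1) y := by
    intro x y
    rcases le_or_gt 0 x with h0 | h0
    · rcases lt_or_ge x a with h1 | h1
      · have := (hN.row_step (x + 1) (max 0 (min y b)) (by omega) (by omega) (by omega)
          (by omega)).1
        simp only [M]
        rw [show max 0 (min x (a : ℤ)) = x + 1 - 1 by omega,
          show max 0 (min (x + 1) (a : ℤ)) = x + 1 by omega]
        exact this
      · simp only [M]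
        rw [show max 0 (min x (a : ℤ)) = max 0 (min (x + 1) (a : ℤ)) by omega]
    · simp only [M]
      rw [show max 0 (min x (a : ℤ)) = max 0 (min (x + 1) (a : ℤ)) by omega]
  have hcol : ∀ x y, M x y ≤ M x (y + 1) := by
    intro x y
    rcases le_or_gt 0 y with h0 | h0
    · rcases lt_or_ge y b with h1 | h1
      · have := (hN.col_step (max 0 (min x a)) (y + 1) (by omega) (by omega) (by omega)
          (by omega)).1
        simp only [M]
        rw [show max 0 (min y (b : ℤ)) = y + 1 - 1 by omega,
          show max 0 (min (y + 1) (b : ℤ)) = y + 1 by omega]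
        exact this
      · simp only [M]
        rw [show max 0 (min y (b : ℤ)) = max 0 (min (y + 1) (b : ℤ)) by omega]
    · simp only [M]
      rw [show max 0 (min y (b : ℤ)) = max 0 (min (y + 1) (b : ℤ)) by omega]
  have hmono : ∀ x y x' y', x ≤ x' → y ≤ y' → M x y ≤ M x' y' := fun x y x' y' hx hy =>
    (monotone_int_of_le_succ (f := fun x => M x y) (fun x => hrow x y) hx).trans
      (monotone_int_of_le_succ (f := fun y => M x' y) (fun y => hcol x' y) hy)
  have hbot : ∀ (k : Fin p.r) (y : ℤ), (k : ℤ) < M a y ↔ (p.beta k : ℤ) ≤ y := by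
    intro k y
    have h1 := p.beta_mem k
    rcases le_or_gt y 0 with h | h
    · rw [hM0 _ _ (Or.inr h)]
      omega
    · simp only [M]
      rw [min_self, max_eq_right (by omega), hN.bottom _ (by omega) (by omega),
        ← p.beta_le_iff k]
      omega
  have hright : ∀ (k : Fin p.r) (x : ℤ), (k : ℤ) < M x b ↔ (p.alpha k : ℤ) ≤ x := by
    intro k x
    have h1 := p.alpha_mem k
    rcases le_or_gt x 0 with h | h
    · rw [hM0 _ _ (Or.inl h)]
      omega
    · simp only [M]
      rw [min_self, max_eq_right (a := 0) (b := (b : ℤ)) (by omega),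
        hN.right _ (by omega) (by omega), ← p.alpha_le_iff k]
      omega
  have hex : ∀ (k : Fin p.r) (z : ℤ), ∃ u, (p.beta k : ℤ) - a ≤ z → z ≤ b - p.alpha k →
      ∀ x, (k : ℤ) < M x (x + z) ↔ u ≤ x := by
    intro k z
    by_cases hz : (p.beta k : ℤ) - a ≤ z
    · obtain ⟨u, hu, hu'⟩ := Int.exists_least_of_bdd (P := fun x => (k : ℤ) < M x (x + z))
        ⟨0, fun x hx => by
          by_contra! h
          rw [hM0 _ _ (Or.inl h.le)] at hx
          omega⟩ ⟨a, (hbot k _).2 (by omega)⟩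
      exact ⟨u, fun _ _ x => ⟨hu' x, fun h => hu.trans_le (hmono _ _ _ _ h (by omega))⟩⟩
    · exact ⟨0, fun h => absurd h hz⟩
  choose F hF using hex
  have hpath : ∀ k, IsPathFn a b (p.alpha k) (p.beta k) (F k) := by
    intro k
    have hα := p.alpha_mem k
    have hβ := p.beta_mem k
    refine ⟨?_, ?_, fun z h1 h2 => ⟨?_, ?_⟩⟩
    · have h1 := hF k (p.beta k - a) (by omega) (by omega)
      have h2 := (h1 a).1 ((hbot k _).2 (by omega))
      have h3 := (h1 (a - 1)).not.1 fun h => by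
        have := (hbot k (a - 1 + (p.beta k - a))).1
          (h.trans_le (hmono _ _ _ _ (by omega) le_rfl))
        omega
      omega
    · have h1 := hF k (b - p.alpha k) (by omega) (by omega)
      have h2 := (h1 (p.alpha k)).1 (by
        rw [add_sub_cancel]
        exact (hright k _).2 le_rfl)
      have h3 := (h1 (p.alpha k - 1)).not.1 fun h => by
        have := (hright k (p.alpha k - 1)).1
          (h.trans_le (hmono _ _ _ _ le_rfl (by omega)))
        omega
      omega
    · exact (hF k (z + 1) (by omega) (by omega) _).1
        (((hF k z h1 h2.le _).2 le_rfl).trans_le (hmono _ _ _ _ le_rfl (by omega)))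
    · exact (hF k z h1 h2.le _).1
        (((hF k (z + 1) (by omega) (by omega) _).2 le_rfl).trans_le
          (hmono _ _ _ _ (by omega) (by omega)))
  refine ⟨F, ⟨hpath, ?_⟩, ?_⟩
  · intro k k' hk
    refine hN.oscFn hk (hpath k) (hpath k') (fun z h1 h2 x hx hx' hy hy' => ?_)
      (fun z h1 h2 x hx hx' hy hy' => ?_)
    · rw [← hMN _ _ hx hx' hy hy', hF k z h1 h2]
    · rw [← hMN _ _ hx hx' hy hy', hF k' z h1 h2]
  · intro x y hxy
    rw [mem_rect] at hxy
    dsimp only at hxy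
    rw [← hMN x y (by omega) (by omega) (by omega) (by omega),
      ← hMN (x - 1) (y - 1) (by omega) (by omega) (by omega) (by omega)]
    have hle : M x y ≤ p.r := by
      refine (hmono x y a y (by omega) le_rfl).trans ?_
      rw [hMN a y (by omega) (by omega) (by omega) (by omega), hN.bottom y (by omega) (by omega)]
      exact p.countLE_cols_le y
    have hge : 0 ≤ M (x - 1) (y - 1) := by
      rw [← hM0 0 0 (by simp)]
      exact hmono _ _ _ _ (by omega) (by omega)
    have hle' := hmono (x - 1) (y - 1) x y (by omega) (by omega)
    have hset : (Finset.univ.filter fun k => OnPath p F k x y) =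
        Finset.univ.filter fun k : Fin p.r => M (x - 1) (y - 1) ≤ (k : ℤ) ∧ (k : ℤ) < M x y := by
      ext k
      simp only [Finset.mem_filter, Finset.mem_univ, true_and]
      unfold OnPath
      have h1 : (k : ℤ) < M x y → (p.beta k : ℤ) - a ≤ y - x ∧ y - x ≤ b - p.alpha k := by
        intro h
        have h1 := (hbot k (a + (y - x))).1 (h.trans_le (hmono _ _ _ _ (by omega) (by omega)))
        have h2 := (hright k (b - (y - x))).1 (h.trans_le (hmono _ _ _ _ (by omega) (by omega)))
        omega
      by_cases h2 : (p.beta k : ℤ) - a ≤ y - x ∧ y - x ≤ b - p.alpha k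
      · have h3 := hF k (y - x) h2.1 h2.2 x
        have h4 := hF k (y - x) h2.1 h2.2 (x - 1)
        rw [show x + (y - x) = y by ring] at h3
        rw [show x - 1 + (y - x) = y - 1 by ring] at h4
        constructor
        · rintro ⟨-, -, h5⟩
          exact ⟨by omega, by omega⟩
        · rintro ⟨h5, h6⟩
          exact ⟨h2.1, h2.2, by omega⟩
      · exact ⟨fun h => absurd ⟨h.1, h.2.1⟩ h2, fun h => absurd (h1 h.2) h2⟩
    rw [hset, card_filter_Ico hge hle' hle]
    ring

open Classical in
lemma mem_vacOscSet_iff {r : ℕ} (P : Fin r → List (ℤ × ℤ)) (x : ℤ × ℤ) :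
    x ∈ vacOscSet a b P ↔ x ∈ rect a b ∧ (Finset.univ.filter fun k => x ∈ P k).card ≠ 1 := by
  have h0 : (∀ k, x ∉ P k) ↔ (Finset.univ.filter fun k => x ∈ P k).card = 0 := by
    simp [Finset.filter_eq_empty_iff]
  have h2 : (∃ k k', k ≠ k' ∧ x ∈ P k ∧ x ∈ P k') ↔
      1 < (Finset.univ.filter fun k => x ∈ P k).card := by
    rw [Finset.one_lt_card]
    simp only [Finset.mem_filter, Finset.mem_univ, true_and]
    constructor
    · rintro ⟨k, k', h1, h2, h3⟩
      exact ⟨k, h2, k', h3, h1⟩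
    · rintro ⟨k, h2, k', h3, h1⟩
      exact ⟨k, k', h1, h2, h3⟩
  simp only [vacOscSet, vacancies, osculations, Finset.mem_union, Finset.mem_filter]
  rw [h0, h2, ← and_or_left]
  exact and_congr_right fun _ => by omega

open Classical in
lemma vacOscSet_eq_cornerVacOsc {P : Fin p.r → List (ℤ × ℤ)} {F : Fin p.r → ℤ → ℤ}
    {N : ℤ → ℤ → ℤ} (hP : ∀ k x y, (x, y) ∈ P k ↔ OnPath p F k x y)
    (hN : ∀ x y, (x, y) ∈ rect a b →
      N x y = N (x - 1) (y - 1) + ((Finset.univ.filter fun k => OnPath p F k x y).card : ℤ)) :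
    vacOscSet a b P = cornerVacOsc a b N := by
  ext ⟨x, y⟩
  rw [mem_vacOscSet_iff, cornerVacOsc, Finset.mem_filter]
  refine and_congr_right fun h => ?_
  dsimp only
  rw [hN x y h]
  simp only [hP]
  omega

/-- Vacancy-osculation sets in terms of corner sum functions. -/
theorem mem_VOS_iff {l : ℕ} {S : Finset (ℤ × ℤ)} :
    S ∈ VOS a b p l ↔ S.card = l ∧ ∃ N, IsCornerSum p N ∧ cornerVacOsc a b N = S := by
  constructor
  · rintro ⟨P, ⟨hP, hl⟩, rfl⟩
    obtain ⟨F, hF, hFP⟩ := exists_isOscFamily hP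
    obtain ⟨N, hN, hFN⟩ := hF.exists_isCornerSum
    exact ⟨hl, N, hN, (vacOscSet_eq_cornerVacOsc hFP hFN).symm⟩
  · rintro ⟨hl, N, hN, rfl⟩
    obtain ⟨F, hF, hFN⟩ := hN.exists_isOscFamily
    obtain ⟨P, hP, hFP⟩ := hF.exists_mem_OP
    have := vacOscSet_eq_cornerVacOsc hFP hFN
    exact ⟨P, ⟨hP, this ▸ hl⟩, this⟩

end Family

/-! ## Progressions -/

/-- The order on lattice points by level and then, for equal levels, by content. -/
def PointLT (L : ℤ × ℤ → ℤ) (prec : ℤ → ℤ → Prop) (x y : ℤ × ℤ) : Prop :=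
  L x < L y ∨ (L x = L y ∧ prec (x.2 - x.1) (y.2 - y.1))

/-- With the next two lemmas: `pointOf q` is inverse to taking level and content. The four cases of
`pointOf` record which term attains the maximum in `level`. -/
lemma level_pointOf (q u z : ℤ) : level q (pointOf q u z) = u := by
  unfold level pointOf
  split_ifs <;> dsimp only <;> omega

lemma content_pointOf (q u z : ℤ) : (pointOf q u z).2 - (pointOf q u z).1 = z := by
  unfold pointOf
  split_ifs <;> dsimp only <;> omega

lemma pointOf_level (q : ℤ) (x : ℤ × ℤ) : pointOf q (level q x) (x.2 - x.1) = x := by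
  unfold level pointOf
  rw [Prod.ext_iff]
  split_ifs <;> dsimp only <;> omega

lemma level_mem_Icc {a b : ℕ} {x : ℤ × ℤ} (hx : x ∈ rect a b) :
    level ((b : ℤ) - a) x ∈ Set.Icc 1 (min (a : ℤ) b) := by
  rw [mem_rect] at hx
  unfold level
  rw [Set.mem_Icc]
  split_ifs <;> omega

/-- Trichotomy holds because level and content together determine a point. -/
lemma isStrictTotalOrder_pointLT (q : ℤ) {prec : ℤ → ℤ → Prop} (h : IsStrictTotalOrder ℤ prec) :
    IsStrictTotalOrder (ℤ × ℤ) (PointLT (level q) prec) where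
  trichotomous x y h1 h2 := by
    simp only [PointLT, not_or, not_lt, not_and] at h1 h2
    have hL : level q x = level q y := le_antisymm h2.1 h1.1
    have hc := h.trichotomous _ _ (h1.2 hL) (h2.2 hL.symm)
    rw [← pointOf_level q x, ← pointOf_level q y, hL, hc]
  irrefl x hx := by
    rcases hx with hx | hx
    · exact lt_irrefl _ hx
    · exact h.irrefl _ hx.2
  trans x y z hxy hyz := by
    rcases hxy with hxy | ⟨hxy, hxy'⟩ <;> rcases hyz with hyz | ⟨hyz, hyz'⟩
    · exact Or.inl (hxy.trans hyz)
    · exact Or.inl (hxy.trans_eq hyz)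
    · exact Or.inl (hxy.trans_lt hyz)
    · exact Or.inr ⟨hxy.trans hyz, h.trans _ _ _ hxy' hyz'⟩

lemma rel_of_forall_succ {α : Type*} {r : α → α → Prop} [IsTrans α r] {l : ℕ} {s : Fin l → α}
    (h : ∀ k k' : Fin l, (k' : ℕ) = k + 1 → r (s k) (s k')) (k k' : Fin l) (hk : k < k') :
    r (s k) (s k') := by
  suffices H : ∀ (n : ℕ) (k' : Fin l), (k' : ℕ) = k + n + 1 → r (s k) (s k') from
    H (k' - k - 1) k' (by rw [Fin.lt_def] at hk; omega)
  intro n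
  induction n with
  | zero => exact fun k' hk' => h k k' hk'
  | succ n ih =>
    intro k' hk'
    exact _root_.trans (ih ⟨k + n + 1, by omega⟩ rfl) (h _ k' (by dsimp only; omega))

lemma existsUnique_sorted {α : Type*} (r : α → α → Prop) [IsStrictTotalOrder α r] [DecidableEq α]
    (S : Finset α) {l : ℕ} (h : S.card = l) :
    ∃! s : Fin l → α, Finset.univ.image s = S ∧ ∀ k k', k < k' → r (s k) (s k') := by
  classical
  let := linearOrderOfSTO r
  refine ⟨S.orderEmbOfFin h, ⟨?_, fun k k' hk => (S.orderEmbOfFin h).strictMono hk⟩, ?_⟩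
  · rw [← Finset.coe_inj, Finset.coe_image, Finset.coe_univ, Set.image_univ,
      Finset.range_orderEmbOfFin]
  · rintro s ⟨rfl, hs'⟩
    exact Finset.orderEmbOfFin_unique h (fun k => Finset.mem_image_of_mem _ (Finset.mem_univ k))
      fun k k' hk => hs' k k' hk

section Progression

variable {a b l : ℕ} {q : ℤ} {prec : ℤ → ℤ → Prop}

/-- Transitivity passes from neighbouring terms to all pairs, and the axiom of an ordering pair
makes the sorted order canonical. So an induced progression is just the sorted enumeration of `S`.
-/
lemma isInducedProgression_iff (hprec : IsOrderingPair (level q) prec) {S : Finset (ℤ × ℤ)}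
    (hS : S ⊆ rect a b) {s : Fin l → ℤ × ℤ} :
    IsInducedProgression (level q) prec S s ↔
      Finset.univ.image s = S ∧ ∀ k k', k < k' → PointLT (level q) prec (s k) (s k') := by
  have hO := isStrictTotalOrder_pointLT q hprec.strictTotal
  constructor
  · exact fun h => ⟨h.image_eq, rel_of_forall_succ h.increasing⟩
  · rintro ⟨h1, h2⟩
    refine ⟨fun k k' hk => ?_, h1, fun k k' hk => ?_, fun k k' hk => h2 k k' ?_⟩
    · rcases lt_trichotomy k k' with h | h | h
      · have := h2 _ _ h
        rw [hk] at this
        exact (hO.irrefl _ this).elim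
      · exact h
      · have := h2 _ _ h
        rw [hk] at this
        exact (hO.irrefl _ this).elim
    · have hm : ∀ k, 1 ≤ (s k).1 ∧ 1 ≤ (s k).2 := fun k => by
        have := mem_rect.1 (hS (h1 ▸ Finset.mem_image_of_mem s (Finset.mem_univ k)))
        omega
      exact hprec.order _ _ _ _ (hm k).1 (hm k).2 (hm k').1 (hm k').2 (h2 k k' hk)
    · rw [Fin.lt_def]
      omega

lemma existsUnique_isInducedProgression (hprec : IsOrderingPair (level q) prec)
    {S : Finset (ℤ × ℤ)} (hS : S ⊆ rect a b) (hl : S.card = l) :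
    ∃! s : Fin l → ℤ × ℤ, IsInducedProgression (level q) prec S s := by
  have hO := isStrictTotalOrder_pointLT q hprec.strictTotal
  simp only [isInducedProgression_iff hprec hS]
  exact existsUnique_sorted _ S hl

lemma inducedProgression_eq (hprec : IsOrderingPair (level q) prec)
    {S : Finset (ℤ × ℤ)} (hS : S ⊆ rect a b) {s : Fin l → ℤ × ℤ}
    (hs : IsInducedProgression (level q) prec S s) :
    inducedProgression (level q) prec l S = s := by
  have hl : S.card = l := by
    rw [← hs.image_eq, Finset.card_image_of_injective _ hs.injective, Finset.card_fin]
  exact (existsUnique_isInducedProgression hprec hS hl).unique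
    (Classical.epsilon_spec ⟨s, hs⟩) hs

lemma IsAssociatedTableau.unique {s : Fin l → ℤ × ℤ} {η η' : Fin (l + 1) → YoungDiagram}
    (h : IsAssociatedTableau s η) (h' : IsAssociatedTableau s η') : η = η' := by
  obtain ⟨⟨μ, hμ⟩, hp⟩ := h
  obtain ⟨⟨μ', hμ'⟩, hp'⟩ := h'
  exact eq_of_profile_eq hμ hμ' (funext fun k => (hp k).trans (hp' k).symm)

lemma associatedTableau_eq {s : Fin l → ℤ × ℤ} {η : Fin (l + 1) → YoungDiagram}
    (h : IsAssociatedTableau s η) : associatedTableau s = η :=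
  IsAssociatedTableau.unique (Classical.epsilon_spec ⟨η, h⟩) h

variable {p : BoundaryPair a b}

lemma subset_rect_of_mem_VOS {S : Finset (ℤ × ℤ)} (hS : S ∈ VOS a b p l) : S ⊆ rect a b := by
  obtain ⟨-, N, -, rfl⟩ := mem_VOS_iff.1 hS
  exact Finset.filter_subset _ _

/-- Membership in `VOS` is not presupposed: one direction serves `Theta`, the other `Phi`. -/
lemma mem_VOS_iff_exists_mem_OT {S : Finset (ℤ × ℤ)}
    (hS : S ⊆ rect a b) {s : Fin l → ℤ × ℤ} (hs : IsInducedProgression (level q) prec S s) :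
    S ∈ VOS a b p l ↔ ∃ η ∈ OT p.partition l, ∀ k, profile η k = (s k).2 - (s k).1 := by
  have hl : S.card = l := by
    rw [← hs.image_eq, Finset.card_image_of_injective _ hs.injective, Finset.card_fin]
  rw [← exists_isCornerSum_iff hs.injective hs.canonical
    (fun m => hS (hs.image_eq ▸ Finset.mem_image_of_mem s (Finset.mem_univ m))), mem_VOS_iff,
    hs.image_eq]
  exact and_iff_right hl

/-- The progression and the oscillating tableau of a vacancy-osculation set. -/
lemma exists_theta_eq (hprec : IsOrderingPair (level q) prec) {S : Finset (ℤ × ℤ)}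
    (hS : S ∈ VOS a b p l) :
    ∃ s η, IsInducedProgression (level q) prec S s ∧ η ∈ OT p.partition l ∧
      (∀ k, profile η k = (s k).2 - (s k).1) ∧ inducedProgression (level q) prec l S = s ∧
      Theta (level q) prec l S = (fun k => level q (s k), η) := by
  have hSr := subset_rect_of_mem_VOS hS
  obtain ⟨s, hs, -⟩ := existsUnique_isInducedProgression hprec hSr (mem_VOS_iff.1 hS).1
  obtain ⟨η, hη, hp⟩ := (mem_VOS_iff_exists_mem_OT hSr hs).1 hS
  have h := inducedProgression_eq hprec hSr hs
  refine ⟨s, η, hs, hη, hp, h, ?_⟩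
  rw [Theta, h, associatedTableau_eq ⟨⟨_, hη⟩, hp⟩]

end Progression

/-! ## Generalized oscillating tableaux -/

section GOT

variable {l : ℕ} {q : ℤ} {prec : ℤ → ℤ → Prop}

/-- For contents at least `q` the level depends on the column only. Two vertically adjacent points
with contents `z` and `z + 1` thus share a level, and the order may not go upwards. The shift by
`|z|` keeps the coordinates positive. -/
lemma IsOrderingPair.not_prec_succ (hprec : IsOrderingPair (level q) prec) {z : ℤ} (hz : q ≤ z) :
    ¬prec z (z + 1) := by
  intro h
  have := hprec.order (|z| + 2) (|z| + 2 + z) (|z| + 1) (|z| + 2 + z)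
  have h0 := neg_abs_le z
  have h1 := abs_nonneg z
  have h2 : level q (|z| + 2, |z| + 2 + z) = level q (|z| + 1, |z| + 2 + z) := by
    unfold level
    dsimp only
    split_ifs <;> omega
  rw [h2] at this
  have := this (by omega) (by omega) (by omega) (by omega) (Or.inr ⟨rfl, by
    convert h using 1 <;> ring⟩)
  omega

/-- For contents at most `q` the level depends on the row only, and the order may not go left within
a row. -/
lemma IsOrderingPair.not_succ_prec (hprec : IsOrderingPair (level q) prec) {z : ℤ}
    (hz : z + 1 ≤ q) : ¬prec (z + 1) z := by
  intro h
  have := hprec.order (|z| + 2) (|z| + 3 + z) (|z| + 2) (|z| + 2 + z)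
  have h0 := neg_abs_le z
  have h1 := abs_nonneg z
  have h2 : level q (|z| + 2, |z| + 3 + z) = level q (|z| + 2, |z| + 2 + z) := by
    unfold level
    dsimp only
    split_ifs <;> omega
  rw [h2] at this
  have := this (by omega) (by omega) (by omega) (by omega) (Or.inr ⟨rfl, by
    convert h using 1 <;> ring⟩)
  omega

lemma edge_eq_of_forall_profile_ne {μ : YoungDiagram} {η : Fin (l + 1) → YoungDiagram}
    (hη : η ∈ OT μ l) (k : Fin (l + 1)) (z : ℤ)
    (h : ∀ m : Fin l, m.castSucc < k → profile η m ≠ z) : edge (η k) z = max 0 (-z) := by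
  induction k using Fin.induction with
  | zero => rw [hη.1, edge_bot]
  | succ k ih =>
    obtain ⟨ε, -, he⟩ := (hη.2.2 k).edge_eq
    have h1 : diagDiff (η k.castSucc) (η k.succ) ≠ z := h k Fin.castSucc_lt_succ
    rw [he, Pi.add_apply, ih fun m hm => h m (hm.trans Fin.castSucc_lt_succ),
      Pi.single_eq_of_ne (Ne.symm h1), add_zero]

/-- A step with positive content is preceded by a step with the same content or with content smaller
by one, and similarly for negative contents. -/
lemma exists_profile_eq {μ : YoungDiagram} {η : Fin (l + 1) → YoungDiagram}
    (hη : η ∈ OT μ l) (k : Fin l) :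
    (0 < profile η k → ∃ m < k, profile η m = profile η k ∨ profile η m = profile η k - 1) ∧
    (profile η k < 0 → ∃ m < k, profile η m = profile η k ∨ profile η m = profile η k + 1) := by
  obtain ⟨ε, hε, he⟩ := (hη.2.2 k).edge_eq
  change edge (η k.succ) = edge (η k.castSucc) + Pi.single (profile η k) ε at he
  generalize profile η k = z at *
  have hz : edge (η k.succ) z = edge (η k.castSucc) z + ε := by simp [he]
  have hl : edge (η k.succ) (z - 1) = edge (η k.castSucc) (z - 1) := by simp [he]
  have hr : edge (η k.succ) (z + 1) = edge (η k.castSucc) (z + 1) := by simp [he]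
  have hs1 := stepDown_edge (η k.succ) z
  have hs2 := stepDown_edge (η k.succ) (z - 1)
  rw [sub_add_cancel] at hs2
  have hle := le_edge (η k.succ) z
  have hnot := fun w => edge_eq_of_forall_profile_ne hη k.castSucc w
  constructor <;> intro h0 <;> by_contra! h
  -- If neither diagonal has been touched, both carry their values for the empty partition. Adding a
  -- square then violates `StepDown`, and removing one violates `le_edge`.
  · have h1 := hnot z fun m hm => (h m (Fin.castSucc_lt_castSucc_iff.1 hm)).1
    have h2 := hnot (z - 1) fun m hm => (h m (Fin.castSucc_lt_castSucc_iff.1 hm)).2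
    omega
  · have h1 := hnot z fun m hm => (h m (Fin.castSucc_lt_castSucc_iff.1 hm)).1
    have h2 := hnot (z + 1) fun m hm => (h m (Fin.castSucc_lt_castSucc_iff.1 hm)).2
    omega

lemma pointLT_of_mem_GOT (hprec : IsOrderingPair (level q) prec) {T : Set ℤ} {μ : YoungDiagram}
    {x : (Fin l → ℤ) × (Fin (l + 1) → YoungDiagram)} (hx : x ∈ GOT T prec μ l) (k k' : Fin l)
    (hk : k < k') :
    PointLT (level q) prec (pointOf q (x.1 k) (profile x.2 k))
      (pointOf q (x.1 k') (profile x.2 k')) := by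
  have hO := isStrictTotalOrder_pointLT q hprec.strictTotal
  refine rel_of_forall_succ (s := fun k => pointOf q (x.1 k) (profile x.2 k)) (fun k k' hk => ?_)
    k k' hk
  simp only [PointLT, level_pointOf, content_pointOf]
  exact hx.2.2 k k' hk

/-- In a generalized oscillating tableau, the contents are bounded in terms of the levels. -/
lemma profile_bounds_of_mem_GOT (hprec : IsOrderingPair (level q) prec) {T : Set ℤ}
    (hT : ∀ u ∈ T, 1 ≤ u) {μ : YoungDiagram} {x : (Fin l → ℤ) × (Fin (l + 1) → YoungDiagram)}
    (hx : x ∈ GOT T prec μ l) (k : Fin l) :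
    1 - x.1 k + min q 0 ≤ profile x.2 k ∧ profile x.2 k ≤ x.1 k - 1 + max q 0 := by
  induction k using WellFoundedLT.induction with
  | ind k ih =>
    have h1 := hT _ (hx.1 k)
    obtain ⟨hpos, hneg⟩ := exists_profile_eq hx.2.1 k
    have hlt : ∀ m < k, x.1 m < x.1 k ∨ x.1 m = x.1 k ∧ prec (profile x.2 m) (profile x.2 k) := by
      intro m hm
      simpa only [PointLT, level_pointOf, content_pointOf] using pointLT_of_mem_GOT hprec hx m k hm
    generalize profile x.2 k = z at *
    constructor
    · by_contra! h
      obtain ⟨m, hm, hz⟩ := hneg (by omega)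
      have h2 := ih m hm
      rcases hlt m hm with h3 | ⟨h3, h4⟩
      · omega
      · rcases hz with hz | hz
        · rw [hz] at h4
          exact hprec.strictTotal.irrefl _ h4
        · rw [hz] at h4
          exact hprec.not_succ_prec (by omega) h4
    · by_contra! h
      -- The earlier step has content `z` or `z - 1`. At a smaller level it already breaks its own
      -- bound. At the same level, `z` contradicts irreflexivity, and `z - 1 ≥ q` contradicts
      -- `not_prec_succ`.
      obtain ⟨m, hm, hz⟩ := hpos (by omega)
      have h2 := ih m hm
      rcases hlt m hm with h3 | ⟨h3, h4⟩
      · omega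
      · rcases hz with hz | hz
        · rw [hz] at h4
          exact hprec.strictTotal.irrefl _ h4
        · rw [hz] at h4
          refine hprec.not_prec_succ (z := z - 1) (by omega) ?_
          rwa [sub_add_cancel]

lemma pointOf_mem_rect {a b : ℕ} {u z : ℤ} (hu : u ∈ Set.Icc 1 (min (a : ℤ) b))
    (h : 1 - u + min ((b : ℤ) - a) 0 ≤ z) (h' : z ≤ u - 1 + max ((b : ℤ) - a) 0) :
    pointOf ((b : ℤ) - a) u z ∈ rect a b := by
  rw [Set.mem_Icc] at hu
  rw [mem_rect]
  unfold pointOf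
  split_ifs <;> dsimp only <;> omega

variable {a b : ℕ} {p : BoundaryPair a b}

lemma Phi_subset_rect (hprec : IsOrderingPair (level ((b : ℤ) - a)) prec) {μ : YoungDiagram}
    {x : (Fin l → ℤ) × (Fin (l + 1) → YoungDiagram)}
    (hx : x ∈ GOT (Set.Icc 1 (min (a : ℤ) b)) prec μ l) :
    Phi ((b : ℤ) - a) x ⊆ rect a b := by
  intro y hy
  obtain ⟨k, -, rfl⟩ := Finset.mem_image.1 hy
  have h := profile_bounds_of_mem_GOT hprec (fun u hu => hu.1) hx k
  exact pointOf_mem_rect (hx.1 k) h.1 h.2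

lemma isInducedProgression_Phi (hprec : IsOrderingPair (level ((b : ℤ) - a)) prec)
    {μ : YoungDiagram} {x : (Fin l → ℤ) × (Fin (l + 1) → YoungDiagram)}
    (hx : x ∈ GOT (Set.Icc 1 (min (a : ℤ) b)) prec μ l) :
    IsInducedProgression (level ((b : ℤ) - a)) prec (Phi ((b : ℤ) - a) x)
      fun k => pointOf ((b : ℤ) - a) (x.1 k) (profile x.2 k) :=
  (isInducedProgression_iff hprec (Phi_subset_rect hprec hx)).2
    ⟨rfl, pointLT_of_mem_GOT hprec hx⟩

/-- The points of `Phi` come already sorted, and `x.2` itself is the tableau with their contents as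
profile. -/
lemma mapsTo_Phi (hprec : IsOrderingPair (level ((b : ℤ) - a)) prec) :
    Set.MapsTo (Phi ((b : ℤ) - a)) (GOT (Set.Icc 1 (min (a : ℤ) b)) prec p.partition l)
      (VOS a b p l) := fun x hx =>
  (mem_VOS_iff_exists_mem_OT (Phi_subset_rect hprec hx)
    (isInducedProgression_Phi hprec hx)).2
    ⟨x.2, hx.2.1, fun _ => (content_pointOf _ _ _).symm⟩

lemma mapsTo_Theta (hprec : IsOrderingPair (level ((b : ℤ) - a)) prec) :
    Set.MapsTo (Theta (level ((b : ℤ) - a)) prec l) (VOS a b p l)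
      (GOT (Set.Icc 1 (min (a : ℤ) b)) prec p.partition l) := by
  intro S hS
  obtain ⟨s, η, hs, hη, hp, -, h⟩ := exists_theta_eq hprec hS
  rw [h]
  refine ⟨fun k => level_mem_Icc (subset_rect_of_mem_VOS hS
    (hs.image_eq ▸ Finset.mem_image_of_mem s (Finset.mem_univ k))), hη, fun k k' hk => ?_⟩
  dsimp only
  rw [hp, hp]
  exact hs.increasing k k' hk

lemma invOn_Phi_Theta (hprec : IsOrderingPair (level ((b : ℤ) - a)) prec) :
    Set.InvOn (Phi ((b : ℤ) - a)) (Theta (level ((b : ℤ) - a)) prec l) (VOS a b p l)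
      (GOT (Set.Icc 1 (min (a : ℤ) b)) prec p.partition l) := by
  constructor
  · intro S hS
    obtain ⟨s, η, hs, -, hp, -, h⟩ := exists_theta_eq hprec hS
    rw [h, ← hs.image_eq]
    unfold Phi
    dsimp only
    congr 1
    funext k
    rw [hp, pointOf_level]
  · intro x hx
    rw [Theta, inducedProgression_eq hprec (Phi_subset_rect hprec hx)
      (isInducedProgression_Phi hprec hx),
      associatedTableau_eq (η := x.2) ⟨⟨_, hx.2.1⟩, fun _ => (content_pointOf _ _ _).symm⟩]
    simp only [level_pointOf]

end GOT

end OsculatingPaths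

/-! ### The bijection theorem -/

theorem theorem13 (a b : ℕ) (ha : 1 ≤ a) (hb : 1 ≤ b) (p : OsculatingPaths.BoundaryPair a b)
    (l : ℕ) (prec : ℤ → ℤ → Prop)
    (hprec : OsculatingPaths.IsOrderingPair (OsculatingPaths.level ((b : ℤ) - (a : ℤ))) prec) :
    -- the induced mapping is well-defined
    (∀ S ∈ OsculatingPaths.VOS a b p l,
      (∃! s : Fin l → ℤ × ℤ, OsculatingPaths.IsInducedProgression
        (OsculatingPaths.level ((b : ℤ) - (a : ℤ))) prec S s) ∧
      (∃! η : Fin (l + 1) → YoungDiagram, OsculatingPaths.IsAssociatedTableau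
        (OsculatingPaths.inducedProgression
          (OsculatingPaths.level ((b : ℤ) - (a : ℤ))) prec l S) η)) ∧
    -- it is a bijection
    Set.BijOn (OsculatingPaths.Theta (OsculatingPaths.level ((b : ℤ) - (a : ℤ))) prec l)
      (OsculatingPaths.VOS a b p l)
      (OsculatingPaths.GOT (Set.Icc 1 (min (a : ℤ) (b : ℤ))) prec p.partition l) ∧
    -- its inverse is the explicit mapping `Φ`
    Set.InvOn (OsculatingPaths.Phi ((b : ℤ) - (a : ℤ)))
      (OsculatingPaths.Theta (OsculatingPaths.level ((b : ℤ) - (a : ℤ))) prec l)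
      (OsculatingPaths.VOS a b p l)
      (OsculatingPaths.GOT (Set.Icc 1 (min (a : ℤ) (b : ℤ))) prec p.partition l) := by
  have hinv := OsculatingPaths.invOn_Phi_Theta (p := p) (l := l) hprec
  refine ⟨fun S hS => ?_, hinv.bijOn (OsculatingPaths.mapsTo_Theta hprec)
    (OsculatingPaths.mapsTo_Phi hprec), hinv⟩
  obtain ⟨s, η, hs, hη, hp, h, -⟩ := OsculatingPaths.exists_theta_eq hprec hS
  refine ⟨OsculatingPaths.existsUnique_isInducedProgression hprec
    (OsculatingPaths.subset_rect_of_mem_VOS hS) (OsculatingPaths.mem_VOS_iff.1 hS).1, ?_⟩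
  rw [h]
  exact ⟨η, ⟨⟨_, hη⟩, hp⟩, fun η' h' => h'.unique ⟨⟨_, hη⟩, hp⟩⟩
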